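/- Let $k$ be an algebraically closed field (of any characteristic). Let $\mathcal N\subset\mathfrak{sl}_3(k)$ be the nilpotent cone, i.e. the variety of nilpotent $3\times 3$ matrices, and let $\overline{\mathcal O_{\rm sub}}$ be the Zariski closure of the subregular nilpotent orbit $\mathcal O_{\rm sub}=SL_3(k)\cdot E_{21}$ (the nilpotent matrices of Jordan type $(2,1)$). For a closed set $V$ of $3\times3$ matrices and $r\ge 1$ let \[ C_r(V)=\{(v_1,\dots,v_r)\in V^r \mid [v_i,v_j]=0 \text{ for all } i,j\}, \] regarded as a (reduced) affine variety, and let $C_r^{\rm sing}$ be the singular locus of $C_r(\mathcal N)$, i.e. the set of points at which the local ring of $C_r(\mathcal N)$ is not regular. Then for every $r\ge 1$: \[ C_r^{\rm sing}\subseteq C_r(\overline{\mathcal O_{\rm sub}}),\qquad \dim C_r(\overline{\mathcal O_{\rm sub}})=2r+2, \] and $C_r^{\rm sing}$ has codimension at least $2$ in $C_r(\mathcal N)$, i.e. every prime ideal of the coordinate ring $k[C_r(\mathcal N)]$ that contains all functions vanishing on $C_r^{\rm sing}$ has height at least $2$. -/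

import Mathlib

namespace NilpotentCommuting

/-! ### Affine varieties over an algebraically closed field, as sets of points -/

section Affine

/-- The coordinate ring `k[X] = k[σ] / I(X)` of a subset `X` of the affine space `k^σ`. -/
abbrev CoordRing {k σ : Type*} [Field k] (X : Set (σ → k)) : Type _ :=
  MvPolynomial σ k ⧸ MvPolynomial.vanishingIdeal k X

/-- Evaluation of regular functions at a point `x` of `X`. -/
noncomputable def evalAt {k σ : Type*} [Field k] (X : Set (σ → k)) (x : X) :
    CoordRing X →+* k :=
  Ideal.Quotient.lift (MvPolynomial.vanishingIdeal k X) (MvPolynomial.eval x.1)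
    (fun f hf => by
      have h := MvPolynomial.mem_vanishingIdeal_iff.1 hf x.1 x.2
      rwa [MvPolynomial.aeval_eq_eval] at h)

/-- The (maximal) ideal of `k[X]` of the functions that vanish at `x`. -/
noncomputable def pointIdeal {k σ : Type*} [Field k] (X : Set (σ → k)) (x : X) :
    Ideal (CoordRing X) :=
  RingHom.ker (evalAt X x)

instance pointIdeal_isPrime {k σ : Type*} [Field k] (X : Set (σ → k)) (x : X) :
    (pointIdeal X x).IsPrime :=
  RingHom.ker_isPrime (evalAt X x)

/-- The local ring of `X` at the point `x`. -/
abbrev LocalRingAt {k σ : Type*} [Field k] (X : Set (σ → k)) (x : X) : Type _ :=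
  Localization.AtPrime (pointIdeal X x)

/-- The singular locus: the points of `X` at which the local ring is not regular. -/
def singularLocus {k σ : Type*} [Field k] (X : Set (σ → k)) : Set (σ → k) :=
  {x | ∃ hx : x ∈ X, ¬ IsRegularLocalRing (LocalRingAt X ⟨x, hx⟩)}

/-- The dimension of an affine variety: the Krull dimension of its coordinate ring. -/
noncomputable def dimension {k σ : Type*} [Field k] (X : Set (σ → k)) : WithBot ℕ∞ :=
  ringKrullDim (CoordRing X)

/-- The codimension in `X` of a subset `Z` of `X`: the height of the ideal of `Z` in `k[X]`, that
is, the smallest height of a prime ideal of `k[X]` containing all functions vanishing on `Z`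
(and `⊤` if `Z` is empty). -/
noncomputable def codimension {k σ : Type*} [Field k] (Z X : Set (σ → k)) : ℕ∞ :=
  ((MvPolynomial.vanishingIdeal k Z).map
    (Ideal.Quotient.mk (MvPolynomial.vanishingIdeal k X))).height

end Affine

/-! ### Commuting varieties of 3 by 3 matrices -/

section Matrices

/-- The commuting variety `C_r(V)`: the `r`-tuples of pairwise commuting elements of a set `V` of
3 by 3 matrices, in the affine space of dimension `9 r` whose coordinates are the entries of the
`r` matrices. The bracket is the commutator. -/
def commutingVariety {k : Type*} [Field k] (r : ℕ) (V : Set (Matrix (Fin 3) (Fin 3) k)) :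
    Set (Fin r × Fin 3 × Fin 3 → k) :=
  {x | ∃ v : Fin r → Matrix (Fin 3) (Fin 3) k,
    (∀ i a b, x (i, a, b) = v i a b) ∧ (∀ i, v i ∈ V) ∧ ∀ i j, ⁅v i, v j⁆ = 0}

/-- The nilpotent cone of `sl_3`. -/
def nilpotentCone (k : Type*) [Field k] : Set (Matrix (Fin 3) (Fin 3) k) :=
  {A | A ∈ LieAlgebra.SpecialLinear.sl (Fin 3) k ∧ IsNilpotent A}

/-- The subregular nilpotent orbit: the orbit under conjugation by `SL_3` of the elementary
matrix `E_{21}` (Jordan type `(2, 1)`). -/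
def subregularOrbit (k : Type*) [Field k] : Set (Matrix (Fin 3) (Fin 3) k) :=
  {A | ∃ g : Matrix.SpecialLinearGroup (Fin 3) k,
    A = (g : Matrix (Fin 3) (Fin 3) k) * Matrix.single 1 0 1 *
      ((g⁻¹ : Matrix.SpecialLinearGroup (Fin 3) k) : Matrix (Fin 3) (Fin 3) k)}

/-- The Zariski closure of a set of 3 by 3 matrices. -/
def zariskiClosure {k : Type*} [Field k] (S : Set (Matrix (Fin 3) (Fin 3) k)) :
    Set (Matrix (Fin 3) (Fin 3) k) :=
  {A | ∀ f : MvPolynomial (Fin 3 × Fin 3) k,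
    (∀ B ∈ S, MvPolynomial.eval (fun p => B p.1 p.2) f = 0) →
      MvPolynomial.eval (fun p => A p.1 p.2) f = 0}

end Matrices

end NilpotentCommuting

/-! A nilpotent 3 × 3 matrix M with M² ≠ 0 has a cyclic vector w, and (M²w, Mw, w) is a basis. A
nilpotent matrix commuting with M is aM + bM². Hence the open part of the commuting variety where
the i₀-th matrix has w as a cyclic vector is biregular to a basic open subset of affine space: the
coordinates are Mw, M²w and the pairs (a, b) of the other matrices. So a tuple with some nonzero
square is a regular point (`isRegularLocalRing_of_sq_ne_zero`), and singular tuples consist of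
square-zero matrices, which form the closure of the subregular orbit
(`zariskiClosure_subregularOrbit`).

A square-zero matrix is x ⊗ y with y · x = 0. Commuting ones share a column factor or share a row
factor (`exists_common_of_commute`), so the square-zero commuting variety is a union of two families
exchanged by transposition. Each contains a dense image of affine space of dimension 2r + 2, so the
ideal of the union is an intersection of two primes (`vanishingIdeal_sq_zero`).

Both numerical claims come from one polynomial family with parameters (s, t, c, d), filtered by
letting the last parameters vanish: `famSet` at levels 0, ..., 4 has prime vanishing ideals,
strictly decreasing with the level. Level 2 is the square-zero family. Levels 0 < 1 < 2 start from a
linear space of dimension 2r and bound the dimension below; the upper bound is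
`ringKrullDim_le_of_injective_prod`. Levels 2 < 3 < 4 lie in the nilpotent commuting variety and
give height at least 2, with no need to know its dimension or irreducibility. -/

namespace NilpotentCommuting

open MvPolynomial

/-! ### Images of polynomial maps and their vanishing ideals -/

section PolynomialMaps

variable {k : Type*} [Field k] {σ τ : Type*}

/-- The polynomial map between affine spaces with components `F`. -/
noncomputable def polyMap (F : σ → MvPolynomial τ k) (t : τ → k) : σ → k :=
  fun s => eval t (F s)

theorem eval_polyMap (F : σ → MvPolynomial τ k) (t : τ → k) (f : MvPolynomial σ k) :
    eval (polyMap F t) f = eval t (aeval F f) := by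
  rw [← coe_aeval_eq_eval t, RingHom.coe_coe, ← AlgHom.comp_apply, comp_aeval, ← aeval_eq_eval]
  rfl

theorem mem_vanishingIdeal {X : Set (σ → k)} {f : MvPolynomial σ k} :
    f ∈ vanishingIdeal k X ↔ ∀ x ∈ X, eval x f = 0 := by
  simp [mem_vanishingIdeal_iff, aeval_eq_eval]

theorem vanishingIdeal_range_polyMap [Infinite k] (F : σ → MvPolynomial τ k) :
    vanishingIdeal k (Set.range (polyMap F)) = RingHom.ker (aeval F : MvPolynomial σ k →ₐ[k] _) := by
  ext f
  rw [mem_vanishingIdeal, RingHom.mem_ker]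
  constructor
  · intro h
    refine MvPolynomial.funext fun t => ?_
    rw [map_zero, ← eval_polyMap]
    exact h _ ⟨t, rfl⟩
  · rintro h _ ⟨t, rfl⟩
    rw [eval_polyMap, h, map_zero]

/-- The ideal is the kernel of a map into a polynomial ring, which is a domain; this is
irreducibility of a parametrized set. -/
theorem vanishingIdeal_range_polyMap_isPrime [Infinite k] (F : σ → MvPolynomial τ k) :
    (vanishingIdeal k (Set.range (polyMap F))).IsPrime := by
  rw [vanishingIdeal_range_polyMap]
  exact RingHom.ker_isPrime _

theorem vanishingIdeal_mono {X Y : Set (σ → k)} (h : X ⊆ Y) :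
    vanishingIdeal k Y ≤ vanishingIdeal k X := by
  intro f hf
  rw [mem_vanishingIdeal] at *
  exact fun x hx => hf x (h hx)

end PolynomialMaps

/-! ### Krull dimension bounds -/

section Dimension

theorem ringKrullDim_quotient_add_one_le {R : Type*} [CommRing R] {P Q : Ideal R} [P.IsPrime]
    (h : P < Q) : ringKrullDim (R ⧸ Q) + 1 ≤ ringKrullDim (R ⧸ P) := by
  obtain ⟨f, hfQ, hfP⟩ := Set.exists_of_ssubset h
  have h1 : Ideal.Quotient.mk P f ∈ nonZeroDivisors (R ⧸ P) :=
    mem_nonZeroDivisors_of_ne_zero (by rwa [Ne, Ideal.Quotient.eq_zero_iff_mem])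
  have h2 := ringKrullDim_quotient_succ_le_of_nonZeroDivisor h1
  refine le_trans ?_ h2
  gcongr
  let φ : (R ⧸ P) ⧸ Ideal.span {Ideal.Quotient.mk P f} →+* R ⧸ Q :=
    Ideal.Quotient.lift _ (Ideal.Quotient.factor h.le) (by
      intro a ha
      rw [← RingHom.mem_ker]
      revert a
      change Ideal.span _ ≤ RingHom.ker _
      rw [Ideal.span_le]
      rintro _ rfl
      simpa [RingHom.mem_ker, Ideal.Quotient.eq_zero_iff_mem] using hfQ)
  refine ringKrullDim_le_of_surjective φ ?_
  exact Ideal.Quotient.lift_surjective_of_surjective _ _ (Ideal.Quotient.factor_surjective h.le)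

theorem ringKrullDim_le_of_isIntegral {R S : Type*} [CommRing R] [CommRing S] (f : R →+* S)
    (hf : f.IsIntegral) : ringKrullDim S ≤ ringKrullDim R := by
  algebraize [f]
  refine Order.krullDim_le_of_strictMono
    (fun p : PrimeSpectrum S => PrimeSpectrum.comap (algebraMap R S) p) ?_
  intro p q hpq
  exact Ideal.IsIntegral.comap_lt_comap (R := R) (I := p.asIdeal) (J := q.asIdeal) hpq

/-- Take a Noether normalization of R with s variables. If s exceeded the number of variables of the
target, neither map could be injective on it, by transcendence degree. The product of a kernel
element of each would vanish under both maps, hence be 0, in a domain. -/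
theorem ringKrullDim_le_of_injective_prod {k : Type*} [Field k] {R : Type*} [CommRing R]
    [Nontrivial R] [Algebra k R] [Algebra.FiniteType k R] {ι : Type*} [Finite ι]
    (φ ψ : R →ₐ[k] MvPolynomial ι k) (h : ∀ x, φ x = 0 → ψ x = 0 → x = 0) :
    ringKrullDim R ≤ Nat.card ι := by
  obtain ⟨s, g, hg, hint⟩ := exists_integral_inj_algHom_of_fg k R
  have hs : s ≤ Nat.card ι := by
    by_contra hlt
    have key : ∀ θ : R →ₐ[k] MvPolynomial ι k, ∃ x ≠ 0, θ (g x) = 0 := by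
      intro θ
      by_contra! hno
      have hinj : Function.Injective (θ.comp g) :=
        (injective_iff_map_eq_zero _).2 fun x hx => by
          by_contra hx0
          exact hno x hx0 hx
      have h1 := lift_trdeg_le_of_injective _ hinj
      rw [MvPolynomial.trdeg_of_isDomain, MvPolynomial.trdeg_of_isDomain] at h1
      have := Fintype.ofFinite ι
      simp at h1 hlt
      omega
    obtain ⟨x, hx, hx'⟩ := key φ
    obtain ⟨y, hy, hy'⟩ := key ψ
    have : x * y = 0 := by
      apply hg
      rw [map_zero]
      apply h <;> simp [hx', hy']
    simp_all
  calc ringKrullDim R ≤ ringKrullDim (MvPolynomial (Fin s) k) :=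
        ringKrullDim_le_of_isIntegral g.toRingHom hint
    _ = (s : ℕ) := by simp
    _ ≤ _ := by exact_mod_cast hs

end Dimension

/-! ### Heights of ideals of subvarieties -/

section Height

variable {k : Type*} [Field k] {σ : Type*}

theorem two_le_height_map_vanishingIdeal {X S₀ S₁ S₂ : Set (σ → k)}
    [(vanishingIdeal k S₀).IsPrime] [(vanishingIdeal k S₁).IsPrime] [(vanishingIdeal k S₂).IsPrime]
    (h01 : vanishingIdeal k S₁ < vanishingIdeal k S₀)
    (h12 : vanishingIdeal k S₂ < vanishingIdeal k S₁) (hX : S₂ ⊆ X) :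
    2 ≤ ((vanishingIdeal k S₀).map (Ideal.Quotient.mk (vanishingIdeal k X))).height := by
  have hX' := vanishingIdeal_mono hX
  set q := Ideal.Quotient.mk (vanishingIdeal k X)
  have hq : Function.Surjective q := Ideal.Quotient.mk_surjective
  have hk : RingHom.ker q = vanishingIdeal k X := Ideal.mk_ker
  have := Ideal.map_isPrime_of_surjective hq (I := vanishingIdeal k S₂) (hk.trans_le hX')
  have := Ideal.map_isPrime_of_surjective hq (I := vanishingIdeal k S₁)
    (hk.trans_le (hX'.trans h12.le))
  have := Ideal.map_isPrime_of_surjective hq (I := vanishingIdeal k S₀)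
    (hk.trans_le (hX'.trans (h12.le.trans h01.le)))
  have lt : ∀ {I J : Ideal (MvPolynomial σ k)}, vanishingIdeal k X ≤ I → I < J →
      I.map q < J.map q := by
    intro I J hI hIJ
    refine lt_of_le_not_ge (Ideal.map_mono hIJ.le) fun hle => ?_
    have := Ideal.comap_mono (f := q) hle
    rw [Ideal.comap_map_of_surjective' _ hq, Ideal.comap_map_of_surjective' _ hq, hk,
      sup_eq_left.2 hI, sup_eq_left.2 (hI.trans hIJ.le)] at this
    exact absurd hIJ (not_lt_of_ge this)
  have a1 := Ideal.height_add_one_le_of_lt_of_isPrime (lt hX' h12)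
  have a2 := Ideal.height_add_one_le_of_lt_of_isPrime (lt (hX'.trans h12.le) h01)
  refine le_trans ?_ a2
  have : (1 : ℕ∞) ≤ ((vanishingIdeal k S₁).map q).height := le_trans (by simp) a1
  calc (2 : ℕ∞) = 1 + 1 := by norm_num
    _ ≤ _ := by gcongr

/-- A prime over the image of I ⊓ J pulls back to a prime containing I * J, hence I or J. -/
theorem le_height_map_inf {R S : Type*} [CommRing R] [CommRing S] (f : R →+* S) {I J : Ideal R}
    {n : ℕ∞} (hI : n ≤ (I.map f).height) (hJ : n ≤ (J.map f).height) :
    n ≤ ((I ⊓ J).map f).height := by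
  rw [Ideal.height_eq_inf_minimalPrimes]
  refine le_iInf₂ fun p hp => ?_
  have := hp.isPrime
  have h1 : I * J ≤ p.comap f := Ideal.mul_le_inf.trans (Ideal.map_le_iff_le_comap.1 hp.le)
  rcases (Ideal.IsPrime.mul_le inferInstance).1 h1 with h | h
  · exact hI.trans (Ideal.height_mono (Ideal.map_le_iff_le_comap.2 h))
  · exact hJ.trans (Ideal.height_mono (Ideal.map_le_iff_le_comap.2 h))

end Height

/-! ### Regularity of points is local and invariant under biregular maps -/

theorem isRegularLocalRing_atPrime_iff {R S : Type*} [CommRing R] [CommRing S] [Algebra R S]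
    (M : Submonoid R) [IsLocalization M S] (p : Ideal S) [p.IsPrime] (q : Ideal R) [q.IsPrime]
    (hq : p.comap (algebraMap R S) = q) :
    IsRegularLocalRing (Localization.AtPrime q) ↔ IsRegularLocalRing (Localization.AtPrime p) := by
  have h1 := IsLocalization.isLocalization_isLocalization_atPrime_isLocalization
    M (Localization.AtPrime p) p
  have : IsLocalization q.primeCompl (Localization.AtPrime p) := by
    subst hq
    exact h1
  let e := (IsLocalization.algEquiv q.primeCompl (Localization.AtPrime q)
    (Localization.AtPrime p)).toRingEquiv
  exact ⟨fun _ => IsRegularLocalRing.of_ringEquiv e, fun _ => IsRegularLocalRing.of_ringEquiv e.symm⟩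

theorem IsRegularLocalRing.atPrime_of_ringEquiv {R S : Type*} [CommRing R] [CommRing S]
    (e : R ≃+* S) (p : Ideal S) [p.IsPrime] (q : Ideal R) [q.IsPrime] (hq : q = p.comap e)
    [IsRegularLocalRing (Localization.AtPrime q)] :
    IsRegularLocalRing (Localization.AtPrime p) := by
  subst hq
  exact IsRegularLocalRing.of_ringEquiv <| IsLocalization.ringEquivOfRingEquiv
    (Localization.AtPrime (p.comap e)) (Localization.AtPrime p) e (e.map_primeCompl_comap_eq p)

section RegularFunctions

variable {k : Type*} [Field k] {σ τ : Type*}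

/-- The points of `X` at which the polynomial `h` does not vanish. -/
def basicOpen (X : Set (σ → k)) (h : MvPolynomial σ k) : Set (σ → k) :=
  {x | x ∈ X ∧ eval x h ≠ 0}

/-- The functions on a basic open set that become polynomial after multiplication by a power of
its equation. -/
noncomputable def regFun (X : Set (σ → k)) (h : MvPolynomial σ k) :
    Subalgebra k (basicOpen X h → k) where
  carrier := {F | ∃ (N : ℕ) (P : MvPolynomial σ k), ∀ x, eval x.1 h ^ N * F x = eval x.1 P}
  mul_mem' := by
    rintro F G ⟨N, P, hP⟩ ⟨M, Q, hQ⟩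
    refine ⟨N + M, P * Q, fun x => ?_⟩
    rw [map_mul, ← hP, ← hQ, Pi.mul_apply]
    ring
  add_mem' := by
    rintro F G ⟨N, P, hP⟩ ⟨M, Q, hQ⟩
    refine ⟨N + M, h ^ M * P + h ^ N * Q, fun x => ?_⟩
    rw [map_add, map_mul, map_mul, ← hP, ← hQ, Pi.add_apply, map_pow, map_pow]
    ring
  algebraMap_mem' c := ⟨0, C c, fun x => by simp [Pi.algebraMap_apply]⟩

variable {X : Set (σ → k)} {h : MvPolynomial σ k}

theorem eval_mem_regFun (P : MvPolynomial σ k) : (fun x => eval x.1 P) ∈ regFun X h :=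
  ⟨0, P, fun x => by simp⟩

theorem coord_mem_regFun (s : σ) : (fun x => x.1 s) ∈ regFun X h := by
  simpa using eval_mem_regFun (X := X) (h := h) (MvPolynomial.X s)

theorem inv_mem_regFun : (fun x => (eval x.1 h)⁻¹) ∈ regFun X h :=
  ⟨1, 1, fun x => by simp [mul_inv_cancel₀ x.2.2]⟩

/-- Restriction of regular functions to a basic open set. -/
noncomputable def restrict (X : Set (σ → k)) (h : MvPolynomial σ k) :
    CoordRing X →+* regFun X h :=
  Ideal.Quotient.lift (vanishingIdeal k X)
    { toFun := fun P => ⟨fun x => eval x.1 P, eval_mem_regFun P⟩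
      map_one' := by ext; simp
      map_mul' := fun P Q => by ext; simp
      map_zero' := by ext; simp
      map_add' := fun P Q => by ext; simp }
    (fun f hf => by
      ext x
      exact mem_vanishingIdeal.1 hf x.1 x.2.1)

noncomputable instance : Algebra (CoordRing X) (regFun X h) := (restrict X h).toAlgebra

theorem regFun_isLocalization :
    IsLocalization (Submonoid.powers (Ideal.Quotient.mk (vanishingIdeal k X) h))
      (regFun X h) where
  map_units := by
    rintro ⟨_, N, rfl⟩
    rw [map_pow]
    refine IsUnit.pow _ (.of_mul_eq_one ⟨_, inv_mem_regFun⟩ ?_)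
    ext x
    exact mul_inv_cancel₀ x.2.2
  surj := by
    rintro ⟨F, N, P, hP⟩
    refine ⟨⟨Ideal.Quotient.mk _ P, ⟨Ideal.Quotient.mk _ (h ^ N), N, (map_pow _ _ _).symm⟩⟩, ?_⟩
    ext x
    refine Eq.trans ?_ (hP x)
    change F x * eval x.1 (h ^ N) = _
    rw [map_pow, mul_comm]
  exists_of_eq := by
    intro a b hab
    obtain ⟨P, rfl⟩ := Ideal.Quotient.mk_surjective a
    obtain ⟨Q, rfl⟩ := Ideal.Quotient.mk_surjective b
    -- One power of h suffices: h * P and h * Q agree on all of X, also where h = 0, and the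
    -- coordinate ring is reduced.
    refine ⟨⟨_, 1, rfl⟩, ?_⟩
    change _ ^ 1 * _ = _ ^ 1 * _
    rw [pow_one, ← map_mul, ← map_mul, Ideal.Quotient.eq, mem_vanishingIdeal]
    intro x hx
    by_cases h0 : eval x h = 0
    · simp [h0]
    · have := congrFun (congrArg Subtype.val hab) ⟨x, hx, h0⟩
      have : eval x P = eval x Q := this
      simp [this]

/-- Evaluation of the regular functions on a basic open set at a point. -/
noncomputable def regEval (x : basicOpen X h) : regFun X h →+* k :=
  (Pi.evalRingHom _ x).comp (regFun X h).val.toRingHom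

instance (x : basicOpen X h) : (RingHom.ker (regEval x)).IsPrime := RingHom.ker_isPrime _

/-- Regularity of the local ring at a point can be checked in a basic open neighbourhood. -/
theorem isRegularLocalRing_localRingAt_iff (x : basicOpen X h) :
    IsRegularLocalRing (LocalRingAt X ⟨x.1, x.2.1⟩) ↔
      IsRegularLocalRing (Localization.AtPrime (RingHom.ker (regEval x))) := by
  have := regFun_isLocalization (X := X) (h := h)
  refine isRegularLocalRing_atPrime_iff
    (Submonoid.powers (Ideal.Quotient.mk (vanishingIdeal k X) h)) _ _ ?_
  ext a
  obtain ⟨P, rfl⟩ := Ideal.Quotient.mk_surjective a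
  rfl

variable {Y : Set (τ → k)} {g : MvPolynomial τ k}

theorem comp_mem_regFun (e : basicOpen X h → basicOpen Y g)
    (he : ∀ t, (fun x => (e x).1 t) ∈ regFun X h)
    (hg : (fun x => (eval (e x).1 g)⁻¹) ∈ regFun X h)
    {F : basicOpen Y g → k} (hF : F ∈ regFun Y g) : F ∘ e ∈ regFun X h := by
  obtain ⟨N, P, hP⟩ := hF
  have hQ : ∀ Q : MvPolynomial τ k, (fun x => eval (e x).1 Q) ∈ regFun X h := by
    intro Q
    induction Q using MvPolynomial.induction_on with
    | C a => simpa using eval_mem_regFun (X := X) (h := h) (C a)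
    | add p q hp hq => simpa using! add_mem hp hq
    | mul_X p n hp => simpa using! mul_mem hp (he n)
  have : F ∘ e = (fun x => (eval (e x).1 g)⁻¹) ^ N * fun x => eval (e x).1 P := by
    ext x
    have := pow_ne_zero N (e x).2.2
    simp only [Function.comp_apply, Pi.mul_apply, Pi.pow_apply, ← hP]
    rw [← mul_assoc, ← mul_pow, inv_mul_cancel₀ (e x).2.2, one_pow, one_mul]
  rw [this]
  exact mul_mem (pow_mem hg N) (hQ P)

/-- A biregular map between basic open sets induces an isomorphism of their rings of regular
functions. -/
noncomputable def regFunEquiv (e : basicOpen X h ≃ basicOpen Y g)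
    (he : ∀ t, (fun x => (e x).1 t) ∈ regFun X h)
    (hg : (fun x => (eval (e x).1 g)⁻¹) ∈ regFun X h)
    (he' : ∀ s, (fun y => (e.symm y).1 s) ∈ regFun Y g)
    (hh : (fun y => (eval (e.symm y).1 h)⁻¹) ∈ regFun Y g) :
    regFun Y g ≃+* regFun X h where
  toFun F := ⟨F.1 ∘ e, comp_mem_regFun e he hg F.2⟩
  invFun F := ⟨F.1 ∘ e.symm, comp_mem_regFun e.symm he' hh F.2⟩
  left_inv F := by ext; simp
  right_inv F := by ext; simp
  map_mul' _ _ := rfl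
  map_add' _ _ := rfl

theorem isRegularLocalRing_of_equiv (e : basicOpen X h ≃ basicOpen Y g)
    (he : ∀ t, (fun x => (e x).1 t) ∈ regFun X h)
    (hg : (fun x => (eval (e x).1 g)⁻¹) ∈ regFun X h)
    (he' : ∀ s, (fun y => (e.symm y).1 s) ∈ regFun Y g)
    (hh : (fun y => (eval (e.symm y).1 h)⁻¹) ∈ regFun Y g) (x : basicOpen X h)
    (hreg : IsRegularLocalRing (LocalRingAt Y ⟨(e x).1, (e x).2.1⟩)) :
    IsRegularLocalRing (LocalRingAt X ⟨x.1, x.2.1⟩) := by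
  rw [isRegularLocalRing_localRingAt_iff (e x)] at hreg
  rw [isRegularLocalRing_localRingAt_iff x]
  exact IsRegularLocalRing.atPrime_of_ringEquiv (regFunEquiv e he hg he' hh)
    (RingHom.ker (regEval x)) (RingHom.ker (regEval (e x))) rfl

theorem isRegularLocalRing_affineSpace [Infinite k] [Finite τ] (y : (Set.univ : Set (τ → k))) :
    IsRegularLocalRing (LocalRingAt Set.univ y) := by
  have hbot : vanishingIdeal k (Set.univ : Set (τ → k)) = ⊥ := by
    rw [eq_bot_iff]
    intro f hf
    rw [Ideal.mem_bot]
    exact MvPolynomial.funext fun x => by simpa using mem_vanishingIdeal.1 hf x trivial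
  have : IsRegularRing (CoordRing (Set.univ : Set (τ → k))) :=
    IsRegularRing.of_ringEquiv
      ((RingEquiv.quotientBot _).symm.trans (Ideal.quotEquivOfEq hbot.symm))
  infer_instance

end RegularFunctions

open Matrix

/-! ### Jordan bases through cross products -/

section Frames

variable {k : Type*} [Field k]

theorem eq_of_mulVec_eq {q p w : Fin 3 → k} (hD : q ⬝ᵥ p ⨯₃ w ≠ 0)
    {M N : Matrix (Fin 3) (Fin 3) k} (hq : M *ᵥ q = N *ᵥ q) (hp : M *ᵥ p = N *ᵥ p)
    (hw : M *ᵥ w = N *ᵥ w) : M = N := by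
  rw [triple_product_eq_det] at hD
  have hu : IsUnit (Matrix.of ![q, p, w])ᵀ := by
    rw [Matrix.isUnit_iff_isUnit_det, Matrix.det_transpose, isUnit_iff_ne_zero]
    exact hD
  refine hu.mul_right_cancel ?_
  ext a j
  fin_cases j
  · exact congrFun hq a
  · exact congrFun hp a
  · exact congrFun hw a

/-- The matrix `V` with `V w = p`, `V p = q` and `V q = 0`. -/
noncomputable def jordanMat (q p w : Fin 3 → k) : Matrix (Fin 3) (Fin 3) k :=
  (q ⬝ᵥ p ⨯₃ w)⁻¹ • (vecMulVec p (q ⨯₃ p) + vecMulVec q (w ⨯₃ q))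

/-- The square of `jordanMat`. -/
noncomputable def jordanSq (q p w : Fin 3 → k) : Matrix (Fin 3) (Fin 3) k :=
  (q ⬝ᵥ p ⨯₃ w)⁻¹ • vecMulVec q (q ⨯₃ p)

section

variable {q p w : Fin 3 → k} (hD : q ⬝ᵥ p ⨯₃ w ≠ 0)

theorem cross_dot_rotate (q p w : Fin 3 → k) : q ⨯₃ p ⬝ᵥ w = q ⬝ᵥ p ⨯₃ w := by
  rw [dotProduct_comm, triple_product_permutation]

theorem cross_dot_rotate' (q p w : Fin 3 → k) : w ⨯₃ q ⬝ᵥ p = q ⬝ᵥ p ⨯₃ w := by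
  rw [dotProduct_comm, triple_product_permutation, triple_product_permutation]

theorem cross_dot_left (x y : Fin 3 → k) : x ⨯₃ y ⬝ᵥ x = 0 := by
  rw [dotProduct_comm, dot_self_cross]

theorem cross_dot_right (x y : Fin 3 → k) : x ⨯₃ y ⬝ᵥ y = 0 := by
  rw [dotProduct_comm, dot_cross_self]

theorem smul_vecMulVec_mulVec (c : k) (x y z : Fin 3 → k) :
    (c • vecMulVec x y) *ᵥ z = (c * (y ⬝ᵥ z)) • x := by
  ext a
  simp [mulVec, dotProduct, vecMulVec_apply, Fin.sum_univ_three]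
  ring

-- Divided by the determinant q · (p × w), the vectors q × p, w × q, p × w form the basis dual to w,
-- p, q; this is the source of the formula for `jordanMat`.
include hD in
theorem jordanMat_mulVec₁ : jordanMat q p w *ᵥ w = p := by
  rw [jordanMat, smul_add, add_mulVec, smul_vecMulVec_mulVec, smul_vecMulVec_mulVec,
    cross_dot_rotate, cross_dot_left, inv_mul_cancel₀ hD]
  simp

include hD in
theorem jordanMat_mulVec₂ : jordanMat q p w *ᵥ p = q := by
  rw [jordanMat, smul_add, add_mulVec, smul_vecMulVec_mulVec, smul_vecMulVec_mulVec,
    cross_dot_rotate' q p w, cross_dot_right q p, inv_mul_cancel₀ hD]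
  simp

theorem jordanMat_mulVec₃ : jordanMat q p w *ᵥ q = 0 := by
  rw [jordanMat, smul_add, add_mulVec, smul_vecMulVec_mulVec, smul_vecMulVec_mulVec,
    cross_dot_left, cross_dot_right]
  simp

include hD in
theorem jordanSq_mulVec₁ : jordanSq q p w *ᵥ w = q := by
  rw [jordanSq, smul_vecMulVec_mulVec, cross_dot_rotate, inv_mul_cancel₀ hD, one_smul]

theorem jordanSq_mulVec₂ : jordanSq q p w *ᵥ p = 0 := by
  rw [jordanSq, smul_vecMulVec_mulVec, cross_dot_right]
  simp

theorem jordanSq_mulVec₃ : jordanSq q p w *ᵥ q = 0 := by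
  rw [jordanSq, smul_vecMulVec_mulVec, cross_dot_left]
  simp

include hD in
theorem jordanMat_mul_self : jordanMat q p w * jordanMat q p w = jordanSq q p w := by
  refine eq_of_mulVec_eq hD ?_ ?_ ?_ <;>
  simp [← mulVec_mulVec, jordanMat_mulVec₁ hD, jordanMat_mulVec₂ hD, jordanMat_mulVec₃,
    jordanSq_mulVec₁ hD, jordanSq_mulVec₂, jordanSq_mulVec₃]

include hD in
theorem jordanMat_mul_jordanSq : jordanMat q p w * jordanSq q p w = 0 := by
  refine eq_of_mulVec_eq hD ?_ ?_ ?_ <;>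
  simp [← mulVec_mulVec, jordanMat_mulVec₃,
    jordanSq_mulVec₁ hD, jordanSq_mulVec₂, jordanSq_mulVec₃]

end

theorem pow_three_eq_zero {M : Matrix (Fin 3) (Fin 3) k} (hM : IsNilpotent M) :
    M * (M * M) = 0 := by
  have h1 := (Matrix.isNilpotent_charpoly_sub_pow_of_isNilpotent hM).eq_zero
  have h2 := Matrix.aeval_self_charpoly M
  rw [sub_eq_zero.1 h1] at h2
  simpa [pow_succ, mul_assoc] using h2

theorem trace_eq_zero_of_isNilpotent {M : Matrix (Fin 3) (Fin 3) k} (hM : IsNilpotent M) :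
    M.trace = 0 :=
  (Matrix.isNilpotent_trace_of_isNilpotent hM).eq_zero

theorem mem_nilpotentCone {M : Matrix (Fin 3) (Fin 3) k} :
    M ∈ nilpotentCone k ↔ IsNilpotent M :=
  ⟨fun h => h.2, fun h => ⟨by
    change M ∈ (Matrix.traceLinearMap (Fin 3) k k).ker
    rw [LinearMap.mem_ker]
    exact trace_eq_zero_of_isNilpotent h, h⟩⟩

/-- Applying M² and then M to a linear relation between M²w, Mw and w kills its coefficients one at
a time, because M³ = 0. -/
theorem triple_ne_zero_of_cyclic {M : Matrix (Fin 3) (Fin 3) k} (hM : IsNilpotent M)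
    {w : Fin 3 → k} (hw : M *ᵥ (M *ᵥ w) ≠ 0) :
    (M *ᵥ (M *ᵥ w)) ⬝ᵥ (M *ᵥ w) ⨯₃ w ≠ 0 := by
  have h3 : ∀ z, M *ᵥ (M *ᵥ (M *ᵥ z)) = 0 := fun z => by
    rw [mulVec_mulVec, mulVec_mulVec, mul_assoc, pow_three_eq_zero hM, zero_mulVec]
  intro h0
  rw [triple_product_eq_det] at h0
  obtain ⟨c, hc, hc'⟩ := Matrix.exists_vecMul_eq_zero_iff.2 h0
  have hc' : c 0 • (M *ᵥ (M *ᵥ w)) + c 1 • (M *ᵥ w) + c 2 • w = 0 := by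
    rw [← hc']
    ext a
    simp [vecMul, dotProduct, Fin.sum_univ_three]
  have e1 := congrArg (fun z => M *ᵥ (M *ᵥ z)) hc'
  simp only [mulVec_add, mulVec_smul, h3, mulVec_zero, smul_zero, zero_add] at e1
  have c2 : c 2 = 0 := (smul_eq_zero.1 e1).resolve_right hw
  have e2 := congrArg (fun z => M *ᵥ z) hc'
  simp only [mulVec_add, mulVec_smul, h3, mulVec_zero, smul_zero, zero_add, c2, zero_smul,
    add_zero] at e2
  have c1 : c 1 = 0 := (smul_eq_zero.1 e2).resolve_right hw
  simp only [c1, c2, zero_smul, add_zero] at hc'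
  have c0 : c 0 = 0 := (smul_eq_zero.1 hc').resolve_right hw
  apply hc
  ext a
  fin_cases a <;> simp [c0, c1, c2]

theorem exists_decomposition {q p w : Fin 3 → k} (hD : q ⬝ᵥ p ⨯₃ w ≠ 0) (u : Fin 3 → k) :
    u = ((u ⬝ᵥ q ⨯₃ p) / (q ⬝ᵥ p ⨯₃ w)) • w + ((u ⬝ᵥ w ⨯₃ q) / (q ⬝ᵥ p ⨯₃ w)) • p +
      ((u ⬝ᵥ p ⨯₃ w) / (q ⬝ᵥ p ⨯₃ w)) • q := by
  have key : (q ⬝ᵥ p ⨯₃ w) • u = (u ⬝ᵥ q ⨯₃ p) • w + (u ⬝ᵥ w ⨯₃ q) • p + (u ⬝ᵥ p ⨯₃ w) • q := by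
    ext a
    fin_cases a <;> simp [cross_apply, dotProduct, Fin.sum_univ_three] <;> ring
  calc u = (q ⬝ᵥ p ⨯₃ w)⁻¹ • ((q ⬝ᵥ p ⨯₃ w) • u) := by
        rw [smul_smul, inv_mul_cancel₀ hD, one_smul]
    _ = _ := by
        rw [key]
        simp only [smul_add, smul_smul, div_eq_inv_mul]

theorem smul_one_eq_zero_of_isNilpotent {c : k}
    (h : IsNilpotent (c • (1 : Matrix (Fin 3) (Fin 3) k))) : c = 0 := by
  obtain ⟨n, hn⟩ := h
  rw [smul_pow, one_pow] at hn
  have := congrFun (congrFun hn 0) 0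
  exact eq_zero_of_pow_eq_zero (n := n) (by simpa using this)

end Frames

/-! ### Affine charts of the regular part -/

section Chart

variable {k : Type*} [Field k] {r : ℕ}

/-- The `i`-th matrix of a tuple. -/
def tupleMat {R : Type*} (x : Fin r × Fin 3 × Fin 3 → R) (i : Fin r) :
    Matrix (Fin 3) (Fin 3) R :=
  Matrix.of fun a b => x (i, a, b)

theorem mem_commutingVariety {V : Set (Matrix (Fin 3) (Fin 3) k)} {x : Fin r × Fin 3 × Fin 3 → k} :
    x ∈ commutingVariety r V ↔
      (∀ i, tupleMat x i ∈ V) ∧ ∀ i j, tupleMat x i * tupleMat x j = tupleMat x j * tupleMat x i := by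
  constructor
  · rintro ⟨v, hv, hV, hc⟩
    have : tupleMat x = v := by
      ext i a b
      exact hv i a b
    rw [this]
    exact ⟨hV, fun i j => by simpa [Ring.lie_def, sub_eq_zero] using hc i j⟩
  · rintro ⟨hV, hc⟩
    exact ⟨tupleMat x, fun _ _ _ => rfl, hV, fun i j => by
      rw [Ring.lie_def, hc i j, sub_self]⟩

theorem eq_jordanMat {M : Matrix (Fin 3) (Fin 3) k} (hM : IsNilpotent M) {w : Fin 3 → k}
    (hD : (M *ᵥ (M *ᵥ w)) ⬝ᵥ (M *ᵥ w) ⨯₃ w ≠ 0) :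
    M = jordanMat (M *ᵥ (M *ᵥ w)) (M *ᵥ w) w := by
  refine eq_of_mulVec_eq hD ?_ ?_ ?_
  · rw [jordanMat_mulVec₃, mulVec_mulVec, mulVec_mulVec, mul_assoc, pow_three_eq_zero hM,
      zero_mulVec]
  · rw [jordanMat_mulVec₂ hD]
  · rw [jordanMat_mulVec₁ hD]

/-- Expand Nw = cw + aMw + bM²w by Cramer's rule. As N commutes with M, the identity N = c + aM +
bM² propagates from w to Mw and M²w. Nilpotency of N and M then forces c = 0. The explicit quotients
make the chart coordinates visibly regular functions. -/
theorem eq_of_commute_regular {M N : Matrix (Fin 3) (Fin 3) k} (hM : IsNilpotent M)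
    (hN : IsNilpotent N) (hMN : M * N = N * M) {w : Fin 3 → k}
    (hD : (M *ᵥ (M *ᵥ w)) ⬝ᵥ (M *ᵥ w) ⨯₃ w ≠ 0) :
    N = ((N *ᵥ w ⬝ᵥ w ⨯₃ (M *ᵥ (M *ᵥ w))) / ((M *ᵥ (M *ᵥ w)) ⬝ᵥ (M *ᵥ w) ⨯₃ w)) • M +
      ((N *ᵥ w ⬝ᵥ (M *ᵥ w) ⨯₃ w) / ((M *ᵥ (M *ᵥ w)) ⬝ᵥ (M *ᵥ w) ⨯₃ w)) • (M * M) := by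
  have hdec := exists_decomposition hD (N *ᵥ w)
  set c := (N *ᵥ w ⬝ᵥ (M *ᵥ (M *ᵥ w)) ⨯₃ (M *ᵥ w)) / ((M *ᵥ (M *ᵥ w)) ⬝ᵥ (M *ᵥ w) ⨯₃ w)
  set a := (N *ᵥ w ⬝ᵥ w ⨯₃ (M *ᵥ (M *ᵥ w))) / ((M *ᵥ (M *ᵥ w)) ⬝ᵥ (M *ᵥ w) ⨯₃ w)
  set b := (N *ᵥ w ⬝ᵥ (M *ᵥ w) ⨯₃ w) / ((M *ᵥ (M *ᵥ w)) ⬝ᵥ (M *ᵥ w) ⨯₃ w)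
  have hw : N *ᵥ w = (c • (1 : Matrix (Fin 3) (Fin 3) k) + a • M + b • (M * M)) *ᵥ w := by
    rw [hdec]
    simp only [add_mulVec, smul_mulVec, one_mulVec, ← mulVec_mulVec]
  have hN' : N = c • (1 : Matrix (Fin 3) (Fin 3) k) + a • M + b • (M * M) := by
    have hcomm : ∀ z, N *ᵥ z = (c • (1 : Matrix (Fin 3) (Fin 3) k) + a • M + b • (M * M)) *ᵥ z →
        N *ᵥ (M *ᵥ z) =
          (c • (1 : Matrix (Fin 3) (Fin 3) k) + a • M + b • (M * M)) *ᵥ (M *ᵥ z) := by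
      intro z hz
      rw [mulVec_mulVec, ← hMN, ← mulVec_mulVec, hz, mulVec_mulVec, mulVec_mulVec]
      congr 1
      simp [mul_add, add_mul, mul_assoc]
    exact eq_of_mulVec_eq hD (hcomm _ (hcomm _ hw)) (hcomm _ hw) hw
  have h1 : Commute M N := hMN
  have h2 : IsNilpotent (a • M + b • (M * M)) :=
    Commute.isNilpotent_add (((Commute.refl M).mul_right (Commute.refl M)).smul_right b
      |>.smul_left a) (hM.smul a) (((Commute.refl M).isNilpotent_mul_left hM).smul b)
  have h3 : IsNilpotent (N - (a • M + b • (M * M))) :=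
    Commute.isNilpotent_sub ((h1.symm.smul_right a).add_right
      ((h1.symm.mul_right h1.symm).smul_right b)) hN h2
  have h4 : N - (a • M + b • (M * M)) = c • (1 : Matrix (Fin 3) (Fin 3) k) := by
    nth_rw 1 [hN']
    abel
  rw [h4] at h3
  rw [smul_one_eq_zero_of_isNilpotent h3, zero_smul, zero_add] at hN'
  exact hN'

/-- The index set of the coordinates of the charts of the regular part. -/
abbrev ChartIndex (i₀ : Fin r) : Type := (Fin 2 × Fin 3) ⊕ ({j : Fin r // j ≠ i₀} × Fin 2)

variable {R : Type*} [CommRing R]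

/-- The first (`n = 0`) and second (`n = 1`) image of the cyclic vector. -/
def chartVec {i₀ : Fin r} (t : ChartIndex i₀ → R) (n : Fin 2) : Fin 3 → R :=
  fun a => t (Sum.inl (n, a))

/-- The coefficients of the `j`-th matrix as a polynomial in the `i₀`-th one. -/
def chartCoeff {i₀ : Fin r} (t : ChartIndex i₀ → R) (j : Fin r) (n : Fin 2) : R :=
  if h : j = i₀ then (if n = 0 then 1 else 0) else t (Sum.inr (⟨j, h⟩, n))

/-- The equation of the domain of a chart in the space of tuples. -/
noncomputable def tupleEq (i₀ : Fin r) (w : Fin 3 → k) : MvPolynomial (Fin r × Fin 3 × Fin 3) k :=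
  (tupleMat X i₀ *ᵥ (tupleMat X i₀ *ᵥ fun a => C (w a))) ⬝ᵥ
    (tupleMat X i₀ *ᵥ fun a => C (w a)) ⨯₃ fun a => C (w a)

/-- The equation of the image of a chart in the affine space. -/
noncomputable def chartEq (i₀ : Fin r) (w : Fin 3 → k) : MvPolynomial (ChartIndex i₀) k :=
  chartVec X 1 ⬝ᵥ chartVec X 0 ⨯₃ fun a => C (w a)

theorem eval_tupleEq (i₀ : Fin r) (w : Fin 3 → k) (x : Fin r × Fin 3 × Fin 3 → k) :
    eval x (tupleEq i₀ w) = (tupleMat x i₀ *ᵥ (tupleMat x i₀ *ᵥ w)) ⬝ᵥ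
      (tupleMat x i₀ *ᵥ w) ⨯₃ w := by
  simp [tupleEq, tupleMat, cross_apply, dotProduct, mulVec, Fin.sum_univ_three]

theorem eval_chartEq (i₀ : Fin r) (w : Fin 3 → k) (t : ChartIndex i₀ → k) :
    eval t (chartEq i₀ w) = chartVec t 1 ⬝ᵥ chartVec t 0 ⨯₃ w := by
  simp [chartEq, chartVec, cross_apply, dotProduct, Fin.sum_univ_three]

/-- The coordinates of a tuple in a chart. -/
noncomputable def toChart (i₀ : Fin r) (w : Fin 3 → k) (x : Fin r × Fin 3 × Fin 3 → k) :
    ChartIndex i₀ → k :=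
  Sum.elim
    (fun s => (if s.1 = 0 then tupleMat x i₀ *ᵥ w else tupleMat x i₀ *ᵥ (tupleMat x i₀ *ᵥ w)) s.2)
    (fun s => (tupleMat x s.1 *ᵥ w ⬝ᵥ
      if s.2 = 0 then w ⨯₃ (tupleMat x i₀ *ᵥ (tupleMat x i₀ *ᵥ w))
        else (tupleMat x i₀ *ᵥ w) ⨯₃ w) / eval x (tupleEq i₀ w))

/-- The tuple with given coordinates in a chart. -/
noncomputable def ofChart {i₀ : Fin r} (w : Fin 3 → k) (t : ChartIndex i₀ → k) :
    Fin r × Fin 3 × Fin 3 → k :=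
  fun s => (chartCoeff t s.1 0 • jordanMat (chartVec t 1) (chartVec t 0) w +
    chartCoeff t s.1 1 • jordanSq (chartVec t 1) (chartVec t 0) w) s.2.1 s.2.2

theorem tupleMat_ofChart {i₀ : Fin r} (w : Fin 3 → k) (t : ChartIndex i₀ → k) (j : Fin r) :
    tupleMat (ofChart w t) j = chartCoeff t j 0 • jordanMat (chartVec t 1) (chartVec t 0) w +
      chartCoeff t j 1 • jordanSq (chartVec t 1) (chartVec t 0) w := rfl

theorem tupleMat_ofChart_self {i₀ : Fin r} (w : Fin 3 → k) (t : ChartIndex i₀ → k) :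
    tupleMat (ofChart w t) i₀ = jordanMat (chartVec t 1) (chartVec t 0) w := by
  rw [tupleMat_ofChart]
  simp [chartCoeff]

theorem eval_tupleEq_ofChart {i₀ : Fin r} {w : Fin 3 → k} {t : ChartIndex i₀ → k}
    (ht : eval t (chartEq i₀ w) ≠ 0) :
    eval (ofChart w t) (tupleEq i₀ w) = eval t (chartEq i₀ w) := by
  rw [eval_chartEq] at *
  rw [eval_tupleEq, tupleMat_ofChart_self, jordanMat_mulVec₁ ht, jordanMat_mulVec₂ ht]

theorem eval_chartEq_toChart (i₀ : Fin r) (w : Fin 3 → k) (x : Fin r × Fin 3 × Fin 3 → k) :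
    eval (toChart i₀ w x) (chartEq i₀ w) = eval x (tupleEq i₀ w) := by
  rw [eval_chartEq, eval_tupleEq]
  rfl

theorem ofChart_mem {i₀ : Fin r} {w : Fin 3 → k} {t : ChartIndex i₀ → k}
    (ht : eval t (chartEq i₀ w) ≠ 0) : ofChart w t ∈ commutingVariety r (nilpotentCone k) := by
  rw [eval_chartEq] at ht
  rw [mem_commutingVariety]
  have hV := jordanMat_mul_self ht
  have hVS := jordanMat_mul_jordanSq ht
  simp only [tupleMat_ofChart]
  set V := jordanMat (chartVec t 1) (chartVec t 0) w
  rw [← hV] at hVS ⊢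
  have hnil : IsNilpotent V := ⟨3, by rw [pow_succ, pow_two, mul_assoc, hVS]⟩
  have hc : Commute V (V * V) := (Commute.refl V).mul_right (Commute.refl V)
  refine ⟨fun j => mem_nilpotentCone.2 ?_, fun i j => ?_⟩
  · exact Commute.isNilpotent_add ((hc.smul_right _).smul_left _) (hnil.smul _)
      (((Commute.refl V).isNilpotent_mul_left hnil).smul _)
  · simp only [add_mul, mul_add, smul_mul_smul_comm, mul_assoc]
    rw [mul_comm (chartCoeff t i 0), mul_comm (chartCoeff t i 1),
      mul_comm (chartCoeff t i 0) (chartCoeff t j 1), mul_comm (chartCoeff t i 1)]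
    abel

theorem toChart_ofChart {i₀ : Fin r} {w : Fin 3 → k} {t : ChartIndex i₀ → k}
    (ht : eval t (chartEq i₀ w) ≠ 0) : toChart i₀ w (ofChart w t) = t := by
  have ht' := ht
  rw [eval_chartEq] at ht
  ext (⟨n, a⟩ | ⟨j, n⟩)
  · fin_cases n
    · simp [toChart, tupleMat_ofChart_self, jordanMat_mulVec₁ ht, chartVec]
    · simp [toChart, tupleMat_ofChart_self, jordanMat_mulVec₁ ht, jordanMat_mulVec₂ ht, chartVec]
  · simp only [toChart, Sum.elim_inr, eval_tupleEq_ofChart ht', tupleMat_ofChart_self,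
      jordanMat_mulVec₁ ht, jordanMat_mulVec₂ ht]
    rw [eval_chartEq, tupleMat_ofChart, add_mulVec, smul_mulVec, smul_mulVec,
      jordanMat_mulVec₁ ht, jordanSq_mulVec₁ ht, add_dotProduct, smul_dotProduct, smul_dotProduct,
      div_eq_iff ht]
    fin_cases n
    · have h1 := cross_dot_rotate' (chartVec t 1) (chartVec t 0) w
      have h2 := cross_dot_right w (chartVec t 1)
      rw [dotProduct_comm] at h1 h2
      simp [h1, h2, chartCoeff, j.2]
    · simp [dot_self_cross, chartCoeff, j.2]

theorem ofChart_toChart {i₀ : Fin r} {w : Fin 3 → k} {x : Fin r × Fin 3 × Fin 3 → k}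
    (hx : x ∈ commutingVariety r (nilpotentCone k)) (h : eval x (tupleEq i₀ w) ≠ 0) :
    ofChart w (toChart i₀ w x) = x := by
  obtain ⟨hN, hc⟩ := mem_commutingVariety.1 hx
  have hD := h
  rw [eval_tupleEq] at hD
  have hi := mem_nilpotentCone.1 (hN i₀)
  have h0 := eq_jordanMat hi hD
  have h1 := jordanMat_mul_self hD
  have v0 : chartVec (toChart i₀ w x) 0 = tupleMat x i₀ *ᵥ w := rfl
  have v1 : chartVec (toChart i₀ w x) 1 = tupleMat x i₀ *ᵥ (tupleMat x i₀ *ᵥ w) := rfl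
  suffices ∀ j, tupleMat (ofChart w (toChart i₀ w x)) j = tupleMat x j by
    ext ⟨j, a, b⟩
    exact congrFun (congrFun (this j) a) b
  intro j
  rw [tupleMat_ofChart, v0, v1, ← h1, ← h0]
  by_cases hj : j = i₀
  · subst hj
    simp [chartCoeff]
  · conv_rhs => rw [eq_of_commute_regular hi (mem_nilpotentCone.1 (hN j)) (hc i₀ j) hD]
    simp [chartCoeff, hj, toChart, eval_tupleEq]

/-- The chart of the regular part of the commuting variety defined by a cyclic vector. -/
noncomputable def chartEquiv (i₀ : Fin r) (w : Fin 3 → k) :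
    basicOpen (commutingVariety r (nilpotentCone k)) (tupleEq i₀ w) ≃
      basicOpen Set.univ (chartEq i₀ w) where
  toFun x := ⟨toChart i₀ w x.1, trivial, by rw [eval_chartEq_toChart]; exact x.2.2⟩
  invFun t := ⟨ofChart w t.1, ofChart_mem t.2.2, by rw [eval_tupleEq_ofChart t.2.2]; exact t.2.2⟩
  left_inv x := Subtype.ext (ofChart_toChart x.2.1 x.2.2)
  right_inv t := Subtype.ext (toChart_ofChart t.2.2)

end Chart

/-! ### The charts are biregular -/

section RegularVectors

variable {k : Type*} [Field k] {σ : Type*} {X : Set (σ → k)} {h : MvPolynomial σ k}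

theorem regFun_const (c : k) : (fun _ => c) ∈ regFun X h := (regFun X h).algebraMap_mem c

theorem regFun_dotProduct {u v : basicOpen X h → Fin 3 → k}
    (hu : ∀ a, (fun x => u x a) ∈ regFun X h) (hv : ∀ a, (fun x => v x a) ∈ regFun X h) :
    (fun x => u x ⬝ᵥ v x) ∈ regFun X h := by
  have : (fun x => u x ⬝ᵥ v x) = ∑ a, (fun x => u x a) * fun x => v x a := by
    ext x
    simp [dotProduct]
  rw [this]
  exact sum_mem fun a _ => mul_mem (hu a) (hv a)

theorem regFun_cross {u v : basicOpen X h → Fin 3 → k}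
    (hu : ∀ a, (fun x => u x a) ∈ regFun X h) (hv : ∀ a, (fun x => v x a) ∈ regFun X h) (a : Fin 3) :
    (fun x => (u x ⨯₃ v x) a) ∈ regFun X h := by
  fin_cases a <;> simp only [cross_apply] <;>
  exact sub_mem (mul_mem (hu _) (hv _)) (mul_mem (hu _) (hv _))

end RegularVectors

section Regularity

variable {k : Type*} [Field k] {r : ℕ}

theorem toChart_mem_regFun (i₀ : Fin r) (w : Fin 3 → k) (X : Set (Fin r × Fin 3 × Fin 3 → k))
    (s : ChartIndex i₀) : (fun x => toChart i₀ w x.1 s) ∈ regFun X (tupleEq i₀ w) := by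
  have hm : ∀ (j : Fin r) {v : basicOpen X (tupleEq i₀ w) → Fin 3 → k},
      (∀ a, (fun x => v x a) ∈ regFun X (tupleEq i₀ w)) →
      ∀ a, (fun x => (tupleMat x.1 j *ᵥ v x) a) ∈ regFun X (tupleEq i₀ w) := fun j v hv a =>
    regFun_dotProduct (fun b => coord_mem_regFun (j, a, b)) hv
  have hw : ∀ a, (fun _ : basicOpen X (tupleEq i₀ w) => w a) ∈ regFun X (tupleEq i₀ w) :=
    fun a => regFun_const _
  have hp := hm i₀ hw
  have hq := hm i₀ hp
  rcases s with ⟨n, a⟩ | ⟨j, n⟩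
  · fin_cases n
    · exact hp a
    · exact hq a
  · simp only [toChart, Sum.elim_inr, div_eq_mul_inv]
    refine mul_mem ?_ inv_mem_regFun
    fin_cases n
    · exact regFun_dotProduct (hm j hw) (regFun_cross hw hq)
    · exact regFun_dotProduct (hm j hw) (regFun_cross hp hw)

theorem ofChart_mem_regFun {i₀ : Fin r} (w : Fin 3 → k) (s : Fin r × Fin 3 × Fin 3) :
    (fun t => ofChart w t.1 s) ∈ regFun Set.univ (chartEq i₀ w) := by
  have hw : ∀ a, (fun _ : basicOpen Set.univ (chartEq i₀ w) => w a) ∈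
      regFun Set.univ (chartEq i₀ w) := fun a => regFun_const _
  have hv : ∀ n a, (fun t => chartVec t.1 n a) ∈ regFun Set.univ (chartEq i₀ w) :=
    fun n a => coord_mem_regFun _
  have hc : ∀ j n, (fun t => chartCoeff t.1 j n) ∈ regFun Set.univ (chartEq i₀ w) := by
    intro j n
    by_cases hj : j = i₀
    · simp only [chartCoeff, hj, dite_true]
      exact regFun_const _
    · simp only [chartCoeff, hj, dite_false]
      exact coord_mem_regFun _
  have hD : (fun t => (chartVec t.1 1 ⬝ᵥ chartVec t.1 0 ⨯₃ w)⁻¹) ∈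
      regFun Set.univ (chartEq i₀ w) := by
    simpa only [eval_chartEq] using inv_mem_regFun (X := Set.univ) (h := chartEq i₀ w)
  obtain ⟨j, a, b⟩ := s
  simp only [ofChart, jordanMat, jordanSq, Matrix.add_apply, Matrix.smul_apply, vecMulVec_apply,
    smul_eq_mul]
  exact add_mem
    (mul_mem (hc j 0) (mul_mem hD (add_mem (mul_mem (hv 0 a) (regFun_cross (hv 1) (hv 0) b))
      (mul_mem (hv 1 a) (regFun_cross hw (hv 1) b)))))
    (mul_mem (hc j 1) (mul_mem hD (mul_mem (hv 1 a) (regFun_cross (hv 1) (hv 0) b))))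

theorem isRegularLocalRing_of_sq_ne_zero [Infinite k] {x : Fin r × Fin 3 × Fin 3 → k}
    (hx : x ∈ commutingVariety r (nilpotentCone k)) {i₀ : Fin r}
    (hi : tupleMat x i₀ * tupleMat x i₀ ≠ 0) :
    IsRegularLocalRing (LocalRingAt (commutingVariety r (nilpotentCone k)) ⟨x, hx⟩) := by
  obtain ⟨w, hw⟩ : ∃ w, tupleMat x i₀ *ᵥ (tupleMat x i₀ *ᵥ w) ≠ 0 := by
    by_contra! hno
    refine hi (Matrix.ext_of_mulVec_single fun a => ?_)
    rw [← mulVec_mulVec, hno, zero_mulVec]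
  have hD : eval x (tupleEq i₀ w) ≠ 0 := by
    rw [eval_tupleEq]
    exact triple_ne_zero_of_cyclic (mem_nilpotentCone.1 ((mem_commutingVariety.1 hx).1 i₀)) hw
  refine isRegularLocalRing_of_equiv (chartEquiv i₀ w) (toChart_mem_regFun i₀ w _) ?_
    (ofChart_mem_regFun w) ?_ ⟨x, hx, hD⟩ (isRegularLocalRing_affineSpace _)
  · convert! inv_mem_regFun (X := commutingVariety r (nilpotentCone k)) (h := tupleEq i₀ w) using 3
    exact eval_chartEq_toChart _ _ _
  · convert! inv_mem_regFun (X := Set.univ) (h := chartEq i₀ w) using 3 with t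
    exact eval_tupleEq_ofChart t.2.2

end Regularity

/-! ### Commuting square-zero matrices -/

section SquareZero

variable {k : Type*} [Field k]

theorem exists_smul_of_cross_eq_zero {u v : Fin 3 → k} (hu : u ≠ 0) (h : u ⨯₃ v = 0) :
    ∃ c : k, v = c • u := by
  obtain ⟨a, ha⟩ := Function.ne_iff.1 hu
  have ha : u a ≠ 0 := ha
  have h0 := congrFun h 0
  have h1 := congrFun h 1
  have h2 := congrFun h 2
  simp [cross_apply, sub_eq_zero] at h0 h1 h2
  refine ⟨v a / u a, ?_⟩
  ext b
  rw [Pi.smul_apply, smul_eq_mul, div_mul_eq_mul_div, eq_div_iff ha]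
  fin_cases a <;> fin_cases b <;> simp <;> grind

theorem exists_smul_cross {u v y : Fin 3 → k} (h : u ⨯₃ v ≠ 0) (hu : y ⬝ᵥ u = 0)
    (hv : y ⬝ᵥ v = 0) : ∃ c : k, y = c • (u ⨯₃ v) := by
  refine exists_smul_of_cross_eq_zero h ?_
  rw [cross_cross_eq_smul_sub_smul, dotProduct_comm u, dotProduct_comm v, hu, hv]
  simp

theorem vecMulVec_mul_vecMulVec' (x y z w : Fin 3 → k) :
    vecMulVec x y * vecMulVec z w = (y ⬝ᵥ z) • vecMulVec x w := by
  ext a b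
  simp [mul_apply, vecMulVec_apply, dotProduct, Fin.sum_univ_three]
  ring

theorem vecMulVec_eq_zero' {x y : Fin 3 → k} : vecMulVec x y = 0 ↔ x = 0 ∨ y = 0 := by
  constructor
  · intro h
    by_contra! hxy
    obtain ⟨a, ha⟩ := Function.ne_iff.1 hxy.1
    obtain ⟨b, hb⟩ := Function.ne_iff.1 hxy.2
    have := congrFun (congrFun h a) b
    rw [vecMulVec_apply] at this
    exact mul_ne_zero ha hb this
  · rintro (rfl | rfl) <;> simp

theorem exists_vecMulVec_of_sq_eq_zero {A : Matrix (Fin 3) (Fin 3) k} (h : A * A = 0) :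
    ∃ x y : Fin 3 → k, A = vecMulVec x y ∧ y ⬝ᵥ x = 0 ∧ (x = 0 ↔ y = 0) := by
  by_cases hA : A = 0
  · exact ⟨0, 0, by simp [hA], by simp, by simp⟩
  suffices ∃ x y : Fin 3 → k, A = vecMulVec x y by
    obtain ⟨x, y, rfl⟩ := this
    rw [vecMulVec_eq_zero', not_or] at hA
    refine ⟨x, y, rfl, ?_, by simp [hA]⟩
    rw [vecMulVec_mul_vecMulVec', smul_eq_zero, vecMulVec_eq_zero'] at h
    tauto
  -- Rows are orthogonal to columns: two independent columns make all rows multiples of their cross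
  -- product; otherwise all columns are proportional.
  have hrc : ∀ i j, A i ⬝ᵥ A.col j = 0 := fun i j => congrFun (congrFun h i) j
  obtain ⟨b, hb⟩ : ∃ b, A.col b ≠ 0 := by
    by_contra! hno
    exact hA (by ext i j; exact congrFun (hno j) i)
  by_cases hpar : ∃ j, A.col b ⨯₃ A.col j ≠ 0
  · obtain ⟨j, hj⟩ := hpar
    choose c hc using fun i => exists_smul_cross hj (hrc i b) (hrc i j)
    refine ⟨c, A.col b ⨯₃ A.col j, ?_⟩
    ext i l
    rw [hc i]
    rfl
  · push Not at hpar
    choose c hc using fun j => exists_smul_of_cross_eq_zero hb (hpar j)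
    refine ⟨A.col b, c, ?_⟩
    ext i l
    rw [vecMulVec_apply, mul_comm]
    exact congrFun (hc l) i

theorem exists_common_of_commute {ι : Type*} {A : ι → Matrix (Fin 3) (Fin 3) k}
    (h : ∀ i, A i * A i = 0) (hc : ∀ i j, A i * A j = A j * A i) :
    (∃ x : Fin 3 → k, ∃ y : ι → Fin 3 → k, ∀ i, A i = vecMulVec x (y i) ∧ y i ⬝ᵥ x = 0) ∨
      ∃ x : Fin 3 → k, ∃ y : ι → Fin 3 → k, ∀ i, A i = vecMulVec (y i) x ∧ y i ⬝ᵥ x = 0 := by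
  choose x y hxy horth hiff using fun i => exists_vecMulVec_of_sq_eq_zero (h i)
  -- If y i · x j ≠ 0, multiplying the commutation relation on the left by A i kills one side, which
  -- forces y j · x i = 0; then A i * A j = 0, a contradiction.
  have hdot : ∀ i j, y i ⬝ᵥ x j = 0 := by
    intro i j
    by_contra hne
    have hyi : y i ≠ 0 := fun h0 => hne (by simp [h0])
    have hxj : x j ≠ 0 := fun h0 => hne (by simp [h0])
    have hxi : x i ≠ 0 := fun h0 => hyi ((hiff i).1 h0)
    have hyj : y j ≠ 0 := fun h0 => hxj ((hiff j).2 h0)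
    have e := hc i j
    rw [hxy i, hxy j, vecMulVec_mul_vecMulVec', vecMulVec_mul_vecMulVec'] at e
    have e2 := congrArg (fun M => vecMulVec (x i) (y i) * M) e
    simp only [vecMulVec_mul_vecMulVec', Matrix.mul_smul, horth, zero_smul, smul_zero,
      smul_smul] at e2
    rcases smul_eq_zero.1 e2.symm with h1 | h1
    · rcases mul_eq_zero.1 h1 with h2 | h2
      · rw [h2, zero_smul] at e
        rcases smul_eq_zero.1 e with h3 | h3
        · exact hne h3
        · rcases vecMulVec_eq_zero'.1 h3 with h4 | h4
          · exact hxi h4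
          · exact hyj h4
      · exact hne h2
    · rcases vecMulVec_eq_zero'.1 h1 with h4 | h4
      · exact hxi h4
      · exact hyi h4
  by_cases hx : ∃ i, x i ≠ 0
  · obtain ⟨i, hi⟩ := hx
    by_cases hpar : ∃ j, x i ⨯₃ x j ≠ 0
    · obtain ⟨j, hj⟩ := hpar
      choose c hc' using fun l => exists_smul_cross hj (hdot l i) (hdot l j)
      refine Or.inr ⟨x i ⨯₃ x j, fun l => c l • x l, fun l => ⟨?_, ?_⟩⟩
      · rw [hxy l]
        nth_rw 1 [hc' l]
        ext a b
        simp [vecMulVec_apply]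
        ring
      · rw [smul_dotProduct, ← dotProduct_smul, ← hc' l, dotProduct_comm, horth]
    · push Not at hpar
      choose c hc' using fun j => exists_smul_of_cross_eq_zero hi (hpar j)
      refine Or.inl ⟨x i, fun l => c l • y l, fun l => ⟨?_, ?_⟩⟩
      · rw [hxy l]
        nth_rw 1 [hc' l]
        ext a b
        simp [vecMulVec_apply]
        ring
      · rw [smul_dotProduct, hdot, smul_zero]
  · push Not at hx
    exact Or.inl ⟨0, fun _ => 0, fun l => ⟨by rw [hxy l, hx l]; simp, by simp⟩⟩

end SquareZero

/-! ### The closure of the subregular orbit -/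

section Closure

variable {k : Type*} [Field k]

theorem vecMulVec_mem_subregularOrbit {x y : Fin 3 → k} (hx : x ≠ 0) (hy : y ≠ 0)
    (h : y ⬝ᵥ x = 0) : vecMulVec x y ∈ subregularOrbit k := by
  obtain ⟨a, ha⟩ := Function.ne_iff.1 hx
  obtain ⟨b, hb⟩ := Function.ne_iff.1 hy
  have ha : x a ≠ 0 := ha
  have hb : y b ≠ 0 := hb
  obtain ⟨m, hm⟩ : ∃ m : Fin 3 → k, y ⬝ᵥ m = 1 := ⟨Pi.single b (y b)⁻¹, by simp [hb]⟩
  obtain ⟨n, hn⟩ : ∃ n : Fin 3 → k, x ⬝ᵥ n = 1 := ⟨Pi.single a (x a)⁻¹, by simp [ha]⟩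
  -- The columns satisfy Am = x, Ax = 0 and A(y × n) = 0 for A = x ⊗ y. The third one is chosen so
  -- that det g = (y · m)(x · n) = 1 without rescaling.
  let g : Matrix (Fin 3) (Fin 3) k := (Matrix.of ![m, x, y ⨯₃ n])ᵀ
  have hdet : g.det = 1 := by
    have h1 : m ⬝ᵥ x ⨯₃ (y ⨯₃ n) = 1 := by
      rw [cross_cross_eq_smul_sub_smul', dotProduct_sub, dotProduct_smul, dotProduct_smul, hn,
        h, dotProduct_comm m y, hm]
      simp
    rw [Matrix.det_transpose, ← h1, triple_product_eq_det]
    rfl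
  let G : SpecialLinearGroup (Fin 3) k := ⟨g, hdet⟩
  refine ⟨G, ?_⟩
  have hAg : vecMulVec x y * g = g * Matrix.single 1 0 1 := by
    ext i j
    have hj : (vecMulVec x y * g) i j = x i * (y ⬝ᵥ g.col j) := by
      simp [mul_apply, vecMulVec_apply, dotProduct, Finset.mul_sum, mul_assoc]
    rw [hj]
    fin_cases j
    · have : g.col 0 = m := rfl
      simp [this, hm, g, Matrix.mul_single_apply_same]
    · have : g.col 1 = x := rfl
      simp [this, h]
    · have : g.col 2 = y ⨯₃ n := rfl
      simp [this, dot_self_cross]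
  have hGG : (G : Matrix (Fin 3) (Fin 3) k) * ((G⁻¹ : SpecialLinearGroup (Fin 3) k) :
      Matrix (Fin 3) (Fin 3) k) = 1 :=
    congrArg Subtype.val (mul_inv_cancel G)
  calc vecMulVec x y = vecMulVec x y * (g * (G⁻¹ : SpecialLinearGroup (Fin 3) k)) := by
        rw [hGG, mul_one]
    _ = _ := by rw [← mul_assoc, hAg]

theorem sq_eq_zero_of_mem_subregularOrbit {A : Matrix (Fin 3) (Fin 3) k}
    (hA : A ∈ subregularOrbit k) : A * A = 0 := by
  obtain ⟨g, rfl⟩ := hA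
  have hGG : ((g⁻¹ : SpecialLinearGroup (Fin 3) k) : Matrix (Fin 3) (Fin 3) k) *
      (g : Matrix (Fin 3) (Fin 3) k) = 1 :=
    congrArg Subtype.val (inv_mul_cancel g)
  have hE : (Matrix.single 1 0 1 : Matrix (Fin 3) (Fin 3) k) * Matrix.single 1 0 1 = 0 := by
    simp
  calc _ = (g : Matrix (Fin 3) (Fin 3) k) * (Matrix.single 1 0 1 *
        (((g⁻¹ : SpecialLinearGroup (Fin 3) k) : Matrix (Fin 3) (Fin 3) k) *
      (g : Matrix (Fin 3) (Fin 3) k)) * Matrix.single 1 0 1) *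
        ((g⁻¹ : SpecialLinearGroup (Fin 3) k) : Matrix (Fin 3) (Fin 3) k) := by
        simp only [mul_assoc]
    _ = 0 := by rw [hGG, mul_one, hE, mul_zero, zero_mul]

theorem eval_eq_zero_of_forall_ne_zero [Infinite k] {σ : Type*} (f : MvPolynomial σ k)
    (F : σ → Polynomial k) (h : Polynomial k) (hh : h ≠ 0)
    (hf : ∀ t : k, h.eval t ≠ 0 → eval (fun s => (F s).eval t) f = 0) (t : k) :
    eval (fun s => (F s).eval t) f = 0 := by
  have key : ∀ t, (aeval F f).eval t = eval (fun s => (F s).eval t) f := by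
    intro t
    clear hf
    induction f using MvPolynomial.induction_on with
    | C a => simp
    | add p q hp hq => simp [hp, hq]
    | mul_X p n hp => simp [hp]
  have h0 : h * aeval F f = 0 := by
    refine Polynomial.funext fun t => ?_
    rw [Polynomial.eval_mul, key, Polynomial.eval_zero]
    by_cases ht : h.eval t = 0
    · rw [ht, zero_mul]
    · rw [hf t ht, mul_zero]
  rw [← key, (mul_eq_zero.1 h0).resolve_left hh, Polynomial.eval_zero]

theorem zariskiClosure_subregularOrbit [Infinite k] :
    zariskiClosure (subregularOrbit k) = {A | A * A = 0} := by
  ext A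
  constructor
  · intro hA
    ext a b
    have := hA (∑ c, X (a, c) * X (c, b)) (fun B hB => by
      have := congrFun (congrFun (sq_eq_zero_of_mem_subregularOrbit hB) a) b
      simpa [mul_apply] using this)
    simpa [mul_apply] using this
  · intro hA f hf
    by_cases h0 : A = 0
    · have h1 := eval_eq_zero_of_forall_ne_zero f
        (fun s => Polynomial.X * Polynomial.C ((Matrix.single 1 0 1 : Matrix (Fin 3) (Fin 3) k) s.1 s.2))
        Polynomial.X Polynomial.X_ne_zero (fun t ht => ?_) 0
      · simpa [h0] using h1
      · rw [Polynomial.eval_X] at ht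
        have h2 : t • (Matrix.single 1 0 1 : Matrix (Fin 3) (Fin 3) k) ∈ subregularOrbit k := by
          convert vecMulVec_mem_subregularOrbit (x := Pi.single 1 t) (y := Pi.single 0 1)
            (by simpa using ht) (by simp) (by simp) using 1
          ext a b
          simp [vecMulVec_apply, Matrix.single_apply, Pi.single_apply, eq_comm, ite_and]
          grind
        have h3 := hf _ h2
        simp only [Matrix.smul_apply, smul_eq_mul] at h3
        simp only [Polynomial.eval_mul, Polynomial.eval_X, Polynomial.eval_C, h3]
    · obtain ⟨x, y, rfl, hxy, -⟩ := exists_vecMulVec_of_sq_eq_zero hA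
      rw [vecMulVec_eq_zero', not_or] at h0
      exact hf _ (vecMulVec_mem_subregularOrbit h0.1 h0.2 hxy)

end Closure

/-! ### A four-parameter family of commuting nilpotent matrices -/

section Tuple

variable {R : Type*} {r : ℕ}

/-- The tuple of coordinates of matrices, transposed if `b` is true. -/
def toTuple (b : Bool) (A : Fin r → Matrix (Fin 3) (Fin 3) R) : Fin r × Fin 3 × Fin 3 → R :=
  fun s => if b then A s.1 s.2.2 s.2.1 else A s.1 s.2.1 s.2.2

theorem tupleMat_toTuple (b : Bool) (A : Fin r → Matrix (Fin 3) (Fin 3) R) (i : Fin r) :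
    tupleMat (toTuple b A) i = if b then (A i)ᵀ else A i := by
  cases b <;> rfl

end Tuple

section Family

variable {R : Type*} [CommRing R] {r : ℕ}

/-- The matrix `x ⊗ y + c • u ⊗ z` of the family, where `x = (1, s, t)`, `y = (-t, 0, 1)`,
`u = (0, d, 1)`, `z = x × u` and `m = (s, t, c, d)`. -/
def famN (m : Fin 4 → R) : Matrix (Fin 3) (Fin 3) R :=
  vecMulVec ![1, m 0, m 1] ![-m 1, 0, 1] +
    m 2 • vecMulVec ![0, m 3, 1] ![m 0 - m 3 * m 1, -1, m 3]

/-- The matrix `x ⊗ z` of the family. -/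
def famM (m : Fin 4 → R) : Matrix (Fin 3) (Fin 3) R :=
  vecMulVec ![1, m 0, m 1] ![m 0 - m 3 * m 1, -1, m 3]

/-- A member of a family of commuting nilpotent matrices. -/
def famMat (m : Fin 4 → R) (p : Fin 2 → R) : Matrix (Fin 3) (Fin 3) R :=
  p 0 • famN m + p 1 • famM m

/-- The vectors satisfy y · x = z · x = z · u = 0 and y · u = 1, so only c • x ⊗ z survives. Thus c
≠ 0 makes `famN` regular nilpotent, and c = 0 degenerates it to a square-zero matrix with column
factor x. -/
theorem famN_mul_self (m : Fin 4 → R) : famN m * famN m = m 2 • famM m := by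
  ext i j
  fin_cases i <;> fin_cases j <;>
    simp [famN, famM, mul_apply, Fin.sum_univ_three] <;> ring

theorem famN_mul_famM (m : Fin 4 → R) : famN m * famM m = 0 := by
  ext i j
  fin_cases i <;> fin_cases j <;>
    simp [famN, famM, mul_apply, Fin.sum_univ_three] <;> ring

theorem famM_mul_famN (m : Fin 4 → R) : famM m * famN m = 0 := by
  ext i j
  fin_cases i <;> fin_cases j <;>
    simp [famN, famM, mul_apply, Fin.sum_univ_three] <;> ring

theorem famM_mul_self (m : Fin 4 → R) : famM m * famM m = 0 := by
  ext i j
  fin_cases i <;> fin_cases j <;>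
    simp [famM, mul_apply, Fin.sum_univ_three] <;> ring

theorem famMat_mul (m : Fin 4 → R) (p q : Fin 2 → R) :
    famMat m p * famMat m q = (p 0 * q 0 * m 2) • famM m := by
  simp [famMat, add_mul, mul_add, famN_mul_self, famN_mul_famM, famM_mul_famN, famM_mul_self,
    smul_smul]
  congr 1
  ring

theorem famMat_isNilpotent (m : Fin 4 → R) (p : Fin 2 → R) : IsNilpotent (famMat m p) := by
  refine ⟨3, ?_⟩
  rw [pow_succ, pow_two, famMat_mul, famMat]
  simp [mul_add, famM_mul_famN, famM_mul_self]

variable {k : Type*} [Field k]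

/-- The polynomial parametrization of the part of the family where the last `4 - n` of its four
parameters vanish. -/
noncomputable def famPoly (k : Type*) [Field k] (r : ℕ) (b : Bool) (n : ℕ) :
    Fin r × Fin 3 × Fin 3 → MvPolynomial (Fin n ⊕ Fin r × Fin 2) k :=
  toTuple b fun i => famMat (fun j => if h : j.1 < n then X (Sum.inl ⟨j, h⟩) else 0)
    fun l => X (Sum.inr (i, l))

/-- The set of tuples in the family for which the last `4 - n` parameters vanish. -/
def famSet (k : Type*) [Field k] (r : ℕ) (b : Bool) (n : ℕ) : Set (Fin r × Fin 3 × Fin 3 → k) :=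
  Set.range (polyMap (famPoly k r b n))

theorem polyMap_famPoly (b : Bool) (n : ℕ) (T : Fin n ⊕ Fin r × Fin 2 → k) :
    polyMap (famPoly k r b n) T =
      toTuple b fun i => famMat (fun j => if h : j.1 < n then T (Sum.inl ⟨j, h⟩) else 0)
        fun l => T (Sum.inr (i, l)) := by
  have key : ∀ (m : Fin 4 → MvPolynomial (Fin n ⊕ Fin r × Fin 2) k) (p) (i j : Fin 3),
      eval T (famMat m p i j) = famMat (fun l => eval T (m l)) (fun l => eval T (p l)) i j := by
    intro m p i j
    fin_cases i <;> fin_cases j <;>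
      simp [famMat, famN, famM]
  ext ⟨i, a, c⟩
  have hm : (fun l : Fin 4 => eval T (if h : l.1 < n then
      (X (Sum.inl ⟨l, h⟩) : MvPolynomial (Fin n ⊕ Fin r × Fin 2) k) else 0)) =
      fun l : Fin 4 => if h : l.1 < n then T (Sum.inl ⟨l, h⟩) else 0 := by
    ext l
    split_ifs <;> simp
  cases b <;> simp only [polyMap, famPoly, toTuple, key, hm, eval_X, if_true, if_false,
    Bool.false_eq_true]

theorem mem_famSet {b : Bool} {n : ℕ} {x : Fin r × Fin 3 × Fin 3 → k} :
    x ∈ famSet k r b n ↔ ∃ m : Fin 4 → k, (∀ j : Fin 4, n ≤ j.1 → m j = 0) ∧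
      ∃ p : Fin r → Fin 2 → k, x = toTuple b fun i => famMat m (p i) := by
  constructor
  · rintro ⟨T, rfl⟩
    rw [polyMap_famPoly]
    exact ⟨_, fun j hj => by simp [hj], _, rfl⟩
  · rintro ⟨m, hm, p, rfl⟩
    refine ⟨Sum.elim (fun j => if h : j.1 < 4 then m ⟨j, h⟩ else 0) fun s => p s.1 s.2, ?_⟩
    rw [polyMap_famPoly]
    congr 2
    ext i
    congr 1
    ext j
    by_cases hj : j.1 < n
    · simp [hj]
    · simp [hj, hm j (not_lt.1 hj)]

theorem famSet_mono (b : Bool) {n n' : ℕ} (h : n ≤ n') : famSet k r b n ⊆ famSet k r b n' := by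
  intro x hx
  obtain ⟨m, hm, p, rfl⟩ := mem_famSet.1 hx
  exact mem_famSet.2 ⟨m, fun j hj => hm j (h.trans hj), p, rfl⟩

theorem famSet_subset_nilpotent (b : Bool) (n : ℕ) :
    famSet k r b n ⊆ commutingVariety r (nilpotentCone k) := by
  intro x hx
  obtain ⟨m, hm, p, rfl⟩ := mem_famSet.1 hx
  refine mem_commutingVariety.2 ⟨fun i => mem_nilpotentCone.2 ?_, fun i j => ?_⟩
  · rw [tupleMat_toTuple]
    cases b
    · exact famMat_isNilpotent _ _
    · exact (Matrix.isNilpotent_transpose_iff).2 (famMat_isNilpotent _ _)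
  · rw [tupleMat_toTuple, tupleMat_toTuple]
    cases b
    · simp only [Bool.false_eq_true, if_false, famMat_mul, mul_comm (p i 0)]
    · simp only [if_true, ← transpose_mul, famMat_mul, mul_comm (p i 0)]

theorem famSet_subset_sq_zero (b : Bool) :
    famSet k r b 2 ⊆ commutingVariety r {A : Matrix (Fin 3) (Fin 3) k | A * A = 0} := by
  intro x hx
  refine mem_commutingVariety.2 ⟨fun i => ?_,
    (mem_commutingVariety.1 (famSet_subset_nilpotent b 2 hx)).2⟩
  obtain ⟨m, hm, p, rfl⟩ := mem_famSet.1 hx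
  have h2 : m 2 = 0 := hm 2 le_rfl
  rw [tupleMat_toTuple]
  cases b <;> simp [famMat_mul, ← transpose_mul, h2]

theorem mem_famSet_two_of_ne_zero (b : Bool) {x : Fin 3 → k} (hx : x 0 ≠ 0)
    {y : Fin r → Fin 3 → k} (h : ∀ i, y i ⬝ᵥ x = 0) :
    (toTuple b fun i => vecMulVec x (y i)) ∈ famSet k r b 2 := by
  -- Scale x to (1, s, t) and expand x 0 • y i in the basis (-t, 0, 1), (s, -1, 0) of the orthogonal
  -- plane.
  refine mem_famSet.2 ⟨![x 1 / x 0, x 2 / x 0, 0, 0], ?_,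
    fun i => ![x 0 * y i 2, - (x 0 * y i 1)], ?_⟩
  · intro j hj
    fin_cases j <;> simp at hj ⊢
  · congr 1
    ext i a c
    have hi := h i
    simp only [dotProduct, Fin.sum_univ_three] at hi
    have hy : y i 0 = - (y i 1 * x 1 + y i 2 * x 2) / x 0 := by
      rw [eq_div_iff hx]
      linear_combination hi
    fin_cases a <;> fin_cases c <;>
      simp [famMat, famN, famM, vecMulVec_apply, hy] <;> field_simp

/-- Density: the parametrization reaches only x with nonzero first coordinate (and the zero tuple),
so a general x is approached along a curve inside the family. -/
theorem eval_eq_zero_of_mem_vanishingIdeal_famSet [Infinite k] {b : Bool}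
    {f : MvPolynomial (Fin r × Fin 3 × Fin 3) k} (hf : f ∈ vanishingIdeal k (famSet k r b 2))
    {x : Fin 3 → k} {y : Fin r → Fin 3 → k} (h : ∀ i, y i ⬝ᵥ x = 0) :
    eval (toTuple b fun i => vecMulVec x (y i)) f = 0 := by
  rw [mem_vanishingIdeal] at hf
  by_cases hx : x = 0
  · refine hf _ (mem_famSet.2 ⟨0, fun _ _ => rfl, 0, ?_⟩)
    congr 1
    ext i : 1
    simp [hx, famMat]
  obtain ⟨a, ha⟩ := Function.ne_iff.1 hx
  have ha : x a ≠ 0 := ha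
  obtain ⟨n, hn⟩ : ∃ n : Fin 3 → k, x ⬝ᵥ n = 1 := ⟨Pi.single a (x a)⁻¹, by simp [ha]⟩
  have hy : ∀ i, y i = x ⨯₃ (y i ⨯₃ n) := fun i => by
    rw [cross_cross_eq_smul_sub_smul', hn, h i]
    simp
  -- Move x along the first basis vector. Writing y i = x × (y i × n) lets the row factor follow as
  -- ξ × (y i × n), which stays orthogonal to ξ.
  let ξ : Fin 3 → Polynomial k := fun a => Polynomial.C (x a) + if a = 0 then Polynomial.X else 0
  let F : Fin r × Fin 3 × Fin 3 → Polynomial k :=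
    toTuple b fun i => vecMulVec ξ (ξ ⨯₃ fun c => Polynomial.C ((y i ⨯₃ n) c))
  have hF : ∀ t, (fun s => (F s).eval t) = toTuple b fun i =>
      vecMulVec (fun a => (ξ a).eval t) ((fun a => (ξ a).eval t) ⨯₃ (y i ⨯₃ n)) := by
    intro t
    ext ⟨i, a, c⟩
    cases b
    · fin_cases c <;> simp [F, toTuple, vecMulVec_apply, cross_apply]
    · fin_cases a <;> simp [F, toTuple, vecMulVec_apply, cross_apply]
  have h1 := eval_eq_zero_of_forall_ne_zero f F (ξ 0)
    (by simp [ξ, add_comm, Polynomial.X_add_C_ne_zero]) (fun t ht => by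
      rw [hF]
      exact hf _ (mem_famSet_two_of_ne_zero b ht fun i => cross_dot_left _ _)) 0
  have hξ : (fun a => (ξ a).eval 0) = x := by
    ext a
    by_cases h0 : a = 0 <;> simp [ξ, h0]
  rw [hF, hξ] at h1
  simpa only [← hy] using h1

theorem vanishingIdeal_sq_zero [Infinite k] :
    vanishingIdeal k (commutingVariety r {A : Matrix (Fin 3) (Fin 3) k | A * A = 0}) =
      vanishingIdeal k (famSet k r false 2) ⊓ vanishingIdeal k (famSet k r true 2) := by
  refine le_antisymm (le_inf (vanishingIdeal_mono (famSet_subset_sq_zero _))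
    (vanishingIdeal_mono (famSet_subset_sq_zero _))) ?_
  rintro f ⟨hf, hf'⟩
  rw [mem_vanishingIdeal]
  intro x hx
  obtain ⟨hsq, hc⟩ := mem_commutingVariety.1 hx
  rcases exists_common_of_commute hsq hc with ⟨u, y, h⟩ | ⟨u, y, h⟩
  · have : x = toTuple false fun i => vecMulVec u (y i) := by
      ext ⟨i, a, c⟩
      exact congrFun (congrFun (h i).1 a) c
    rw [this]
    exact eval_eq_zero_of_mem_vanishingIdeal_famSet hf fun i => (h i).2
  · have : x = toTuple true fun i => vecMulVec u (y i) := by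
      ext ⟨i, a, c⟩
      refine (congrFun (congrFun (h i).1 a) c).trans ?_
      simp [toTuple, vecMulVec_apply, mul_comm]
    rw [this]
    exact eval_eq_zero_of_mem_vanishingIdeal_famSet hf' fun i => (h i).2

end Family

/-! ### Chains of primes, dimension and codimension -/

section Chains

variable {k : Type*} [Field k] {r : ℕ}

instance famSet_isPrime [Infinite k] (b : Bool) (n : ℕ) :
    (vanishingIdeal k (famSet k r b n)).IsPrime :=
  vanishingIdeal_range_polyMap_isPrime _

theorem vanishingIdeal_famSet_lt {b : Bool} {n : ℕ} (f : MvPolynomial (Fin r × Fin 3 × Fin 3) k)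
    (h : ∀ x ∈ famSet k r b n, eval x f = 0) (h' : ∃ x ∈ famSet k r b (n + 1), eval x f ≠ 0) :
    vanishingIdeal k (famSet k r b (n + 1)) < vanishingIdeal k (famSet k r b n) := by
  refine lt_of_le_of_ne (vanishingIdeal_mono (famSet_mono b n.le_succ)) fun heq => ?_
  obtain ⟨x, hx, hne⟩ := h'
  exact hne (mem_vanishingIdeal.1 (heq ▸ mem_vanishingIdeal.2 h) x hx)

/-- An entry of a matrix of a tuple as a polynomial, with the indices exchanged if `b` is true. -/
noncomputable def entryPoly (k : Type*) [Field k] (b : Bool) (i : Fin r) (a c : Fin 3) :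
    MvPolynomial (Fin r × Fin 3 × Fin 3) k :=
  if b then X (i, c, a) else X (i, a, c)

theorem eval_entryPoly (b : Bool) (i : Fin r) (a c : Fin 3)
    (A : Fin r → Matrix (Fin 3) (Fin 3) k) :
    eval (toTuple b A) (entryPoly k b i a c) = A i a c := by
  cases b <;> simp [entryPoly, toTuple]

theorem eval_sum_entryPoly (b : Bool) (i : Fin r) (a c : Fin 3)
    (A : Fin r → Matrix (Fin 3) (Fin 3) k) :
    eval (toTuple b A) (∑ j, entryPoly k b i a j * entryPoly k b i j c) = (A i * A i) a c := by
  simp [eval_entryPoly, mul_apply]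

/-- The four separating functions each detect one new parameter: entries (1, 1) and (2, 1) of `famM`
are -s and -t, while entries (0, 1) and (0, 2) of the square of `famN` are -c and cd. -/
theorem famSet_lt₀ (hr : 1 ≤ r) (b : Bool) :
    vanishingIdeal k (famSet k r b 1) < vanishingIdeal k (famSet k r b 0) := by
  refine vanishingIdeal_famSet_lt (entryPoly k b ⟨0, hr⟩ 1 1) ?_ ?_
  · intro x hx
    obtain ⟨m, hm, p, rfl⟩ := mem_famSet.1 hx
    rw [eval_entryPoly]
    simp [famMat, famN, famM, hm]
  · refine ⟨_, mem_famSet.2 ⟨![1, 0, 0, 0], ?_, fun _ => ![0, 1], rfl⟩, ?_⟩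
    · intro j hj
      fin_cases j <;> simp at hj ⊢
    · rw [eval_entryPoly]
      simp [famMat, famN, famM]

theorem famSet_lt₁ (hr : 1 ≤ r) (b : Bool) :
    vanishingIdeal k (famSet k r b 2) < vanishingIdeal k (famSet k r b 1) := by
  refine vanishingIdeal_famSet_lt (entryPoly k b ⟨0, hr⟩ 2 1) ?_ ?_
  · intro x hx
    obtain ⟨m, hm, p, rfl⟩ := mem_famSet.1 hx
    rw [eval_entryPoly]
    simp [famMat, famN, famM, hm]
  · refine ⟨_, mem_famSet.2 ⟨![0, 1, 0, 0], ?_, fun _ => ![0, 1], rfl⟩, ?_⟩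
    · intro j hj
      fin_cases j <;> simp at hj ⊢
    · rw [eval_entryPoly]
      simp [famMat, famN, famM]

theorem famSet_lt₂ (hr : 1 ≤ r) (b : Bool) :
    vanishingIdeal k (famSet k r b 3) < vanishingIdeal k (famSet k r b 2) := by
  refine vanishingIdeal_famSet_lt
    (∑ j, entryPoly k b ⟨0, hr⟩ 0 j * entryPoly k b ⟨0, hr⟩ j 1) ?_ ?_
  · intro x hx
    obtain ⟨m, hm, p, rfl⟩ := mem_famSet.1 hx
    rw [eval_sum_entryPoly, famMat_mul, hm 2 le_rfl]
    simp
  · refine ⟨_, mem_famSet.2 ⟨![0, 0, 1, 0], ?_, fun _ => ![1, 0], rfl⟩, ?_⟩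
    · intro j hj
      fin_cases j <;> simp at hj ⊢
    · rw [eval_sum_entryPoly, famMat_mul]
      simp [famM]

theorem famSet_lt₃ (hr : 1 ≤ r) (b : Bool) :
    vanishingIdeal k (famSet k r b 4) < vanishingIdeal k (famSet k r b 3) := by
  refine vanishingIdeal_famSet_lt
    (∑ j, entryPoly k b ⟨0, hr⟩ 0 j * entryPoly k b ⟨0, hr⟩ j 2) ?_ ?_
  · intro x hx
    obtain ⟨m, hm, p, rfl⟩ := mem_famSet.1 hx
    rw [eval_sum_entryPoly, famMat_mul]
    simp [famM, hm 3 le_rfl]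
  · refine ⟨_, mem_famSet.2 ⟨![0, 0, 1, 1], ?_, fun _ => ![1, 0], rfl⟩, ?_⟩
    · intro j hj
      fin_cases j <;> simp at hj ⊢
    · rw [eval_sum_entryPoly, famMat_mul]
      simp [famM]

theorem two_le_codimension_sq_zero [Infinite k] (hr : 1 ≤ r) :
    2 ≤ codimension (commutingVariety r {A : Matrix (Fin 3) (Fin 3) k | A * A = 0})
      (commutingVariety r (nilpotentCone k)) := by
  have h : ∀ b, 2 ≤ ((vanishingIdeal k (famSet k r b 2)).map (Ideal.Quotient.mk
      (vanishingIdeal k (commutingVariety r (nilpotentCone k))))).height := fun b =>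
    two_le_height_map_vanishingIdeal (famSet_lt₂ hr b) (famSet_lt₃ hr b)
      (famSet_subset_nilpotent b 4)
  rw [codimension, vanishingIdeal_sq_zero]
  exact le_height_map_inf _ (h _) (h _)

/-- At level 0 the matrices are e₀ ⊗ (0, -p₁, p₀), so their entries recover every parameter. -/
theorem famPoly_zero_surjective :
    Function.Surjective (aeval (famPoly k r false 0) :
      MvPolynomial (Fin r × Fin 3 × Fin 3) k →ₐ[k] _) := by
  rw [← AlgHom.range_eq_top, eq_top_iff, ← adjoin_range_X, Algebra.adjoin_le_iff]
  rintro _ ⟨s, rfl⟩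
  rcases s with ⟨j, hj⟩ | ⟨i, l⟩
  · exact absurd hj (Nat.not_lt_zero _)
  · fin_cases l
    · exact ⟨X (i, 0, 2), by simp [famPoly, toTuple, famMat, famN, famM]⟩
    · exact ⟨-X (i, 0, 1), by simp [famPoly, toTuple, famMat, famN, famM]⟩

theorem dimension_sq_zero [Infinite k] (hr : 1 ≤ r) :
    dimension (commutingVariety r {A : Matrix (Fin 3) (Fin 3) k | A * A = 0}) =
      ((2 * r + 2 : ℕ) : WithBot ℕ∞) := by
  set W := commutingVariety r {A : Matrix (Fin 3) (Fin 3) k | A * A = 0}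
  have hle : ∀ b, vanishingIdeal k W ≤ vanishingIdeal k (famSet k r b 2) := fun b =>
    vanishingIdeal_mono (famSet_subset_sq_zero b)
  have : Nontrivial (CoordRing W) := Ideal.Quotient.nontrivial_iff.2 fun h =>
    (famSet_isPrime (k := k) (r := r) false 2).ne_top (top_le_iff.1 (h ▸ hle false))
  refine le_antisymm ?_ ?_
  · let φ : Bool → CoordRing W →ₐ[k] MvPolynomial (Fin 2 ⊕ Fin r × Fin 2) k := fun b =>
      Ideal.Quotient.liftₐ _ (aeval (famPoly k r b 2)) fun f hf => by
        have := hle b hf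
        rwa [famSet, vanishingIdeal_range_polyMap, RingHom.mem_ker] at this
    -- The two parametrizations embed the coordinate ring into a product of two polynomial rings in
    -- 2r + 2 variables.
    have h := ringKrullDim_le_of_injective_prod (φ false) (φ true) (fun x h0 h1 => by
      obtain ⟨f, rfl⟩ := Ideal.Quotient.mk_surjective x
      rw [Ideal.Quotient.eq_zero_iff_mem, vanishingIdeal_sq_zero]
      refine ⟨?_, ?_⟩
      · rw [famSet, vanishingIdeal_range_polyMap]
        exact h0
      · rw [famSet, vanishingIdeal_range_polyMap]
        exact h1)
    refine h.trans (le_of_eq ?_)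
    simp
    norm_cast
    ring
  · have h0 : ((2 * r : ℕ) : WithBot ℕ∞) ≤ ringKrullDim
        (MvPolynomial (Fin r × Fin 3 × Fin 3) k ⧸ vanishingIdeal k (famSet k r false 0)) := by
      rw [famSet, vanishingIdeal_range_polyMap, ringKrullDim_eq_of_ringEquiv
        (Ideal.quotientKerAlgEquivOfSurjective (famPoly_zero_surjective (r := r))).toRingEquiv]
      refine le_of_eq ?_
      simp
      norm_cast
      ring
    have h1 := ringKrullDim_quotient_add_one_le (famSet_lt₀ (k := k) hr false)
    have h2 := ringKrullDim_quotient_add_one_le (famSet_lt₁ (k := k) hr false)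
    have h3 : ringKrullDim (MvPolynomial (Fin r × Fin 3 × Fin 3) k ⧸
        vanishingIdeal k (famSet k r false 2)) ≤ dimension W :=
      ringKrullDim_le_of_surjective _ (Ideal.Quotient.factor_surjective (hle false))
    refine le_trans ?_ (h2.trans h3)
    calc ((2 * r + 2 : ℕ) : WithBot ℕ∞) = ((2 * r : ℕ) : WithBot ℕ∞) + 1 + 1 := by
          push_cast
          rw [add_assoc]
          norm_num
      _ ≤ _ := by
          gcongr
          refine le_trans ?_ h1
          gcongr

end Chains

end NilpotentCommuting

theorem mainTheorem3 (k : Type*) [Field k] [IsAlgClosed k] (r : ℕ) (hr : 1 ≤ r) :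
    NilpotentCommuting.singularLocus
        (NilpotentCommuting.commutingVariety r (NilpotentCommuting.nilpotentCone k)) ⊆
      NilpotentCommuting.commutingVariety r
        (NilpotentCommuting.zariskiClosure (NilpotentCommuting.subregularOrbit k)) ∧
    NilpotentCommuting.dimension
        (NilpotentCommuting.commutingVariety r
          (NilpotentCommuting.zariskiClosure (NilpotentCommuting.subregularOrbit k))) =
      ((2 * r + 2 : ℕ) : WithBot ℕ∞) ∧
    2 ≤ NilpotentCommuting.codimension
        (NilpotentCommuting.singularLocus
          (NilpotentCommuting.commutingVariety r (NilpotentCommuting.nilpotentCone k)))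
        (NilpotentCommuting.commutingVariety r (NilpotentCommuting.nilpotentCone k)) := by
  have : Infinite k := IsAlgClosed.instInfinite
  rw [NilpotentCommuting.zariskiClosure_subregularOrbit (k := k)]
  have hsub : NilpotentCommuting.singularLocus
      (NilpotentCommuting.commutingVariety r (NilpotentCommuting.nilpotentCone k)) ⊆
      NilpotentCommuting.commutingVariety r {A | A * A = 0} := by
    rintro x ⟨hx, hsing⟩
    refine NilpotentCommuting.mem_commutingVariety.2 ⟨fun i => ?_,
      (NilpotentCommuting.mem_commutingVariety.1 hx).2⟩
    by_contra hi
    exact hsing (NilpotentCommuting.isRegularLocalRing_of_sq_ne_zero hx hi)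
  refine ⟨hsub, NilpotentCommuting.dimension_sq_zero hr,
    (NilpotentCommuting.two_le_codimension_sq_zero (k := k) hr).trans ?_⟩
  -- A smaller set has a larger ideal, so the bound passes from the square-zero locus to the
  -- singular locus.
  exact Ideal.height_mono (Ideal.map_mono (NilpotentCommuting.vanishingIdeal_mono hsub))
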